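/- Let $E\in\mathbb R^{n\times n}$ with $\operatorname{rank}E=r<n$ and consider the uncertain discrete-time descriptor system $$E x(k+1)=A_\Delta x(k)+B_\Delta w(k)+B_u u(k),\qquad y(k)=C_\Delta x(k)+D_\Delta w(k),$$ with $x(k)\in\mathbb R^n$, $w(k)\in\mathbb R^q$, $u(k)\in\mathbb R^m$, $y(k)\in\mathbb R^p$, where $A_\Delta=A+M_A\Delta N_A$, $B_\Delta=B_w+M_B\Delta N_B$, $C_\Delta=C+M_C\Delta N_C$, $D_\Delta=D_w+M_D\Delta N_D$ are real matrices and $\Delta\in\mathbb R^{s\times s}$ is unknown with $\|\Delta\|_2\le 1$ (maximal singular value). A pair $(E,\mathcal A)$ is admissible if $\det(zE-\mathcal A)\not\equiv0$, $\deg\det(zE-\mathcal A)=\operatorname{rank}E$, and all complex roots of $\det(zE-\mathcal A)$ satisfy $|z|<1$. A gain $F\in\mathbb R^{m\times n}$ (feedback $u(k)=Fx(k)$) is said to solve the robust $\mathcal H_\infty$ problem with level $\gamma>0$ if for every $\Delta$ with $\|\Delta\|_2\le1$ the pair $(E,A_\Delta+B_uF)$ is admissible and $\|P^{cl}_\Delta\|_\infty<\gamma$,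 where $P^{cl}_\Delta(z)=C_\Delta(zE-(A_\Delta+B_uF))^{-1}B_\Delta+D_\Delta$ and $\|P\|_\infty=\sup_{|z|\ge1}\overline\sigma(P(z))$ ($\overline\sigma$ is the maximal singular value; for admissible systems this is the supremum over $|z|=1$). Let $\overline W,\overline V\in\mathbb R^{n\times n}$ be nonsingular with $\overline WE\overline V=\operatorname{diag}(I_r,0)$, and put $A_d=\overline WA\overline V$, $B_{wd}=\overline WB_w$, $B_{ud}=\overline WB_u$, $C_d=C\overline V$, $M_A^d=\overline WM_A$, $M_B^d=\overline WM_B$, $N_A^d=N_A\overline V$, $N_C^d=N_C\overline V$. **Theorem.** Let $\gamma>0$ and suppose there are $L\in\mathbb R^{r\times r}$ symmetric with $L>0$, $Q\in\mathbb R^{r\times r}$, $R\in\mathbb R^{r\times(n-r)}$, $S\in\mathbb R^{(n-r)\times(n-r)}$, $Z\in\mathbb R^{n\times m}$ and $\varepsilon>0$ such that $$\begin{bmatrix}\Lambda+\varepsilon M_2^{\mathsf T}M_2&N_2\\N_2^{\mathsf T}&-\varepsilon I_{4s}\end{bmatrix}<0,\qquad(\ast)$$ where, with $\Gamma=[\,Q\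 \ R\,]$, $\Omega=[\,I_r\ \ 0\,]$, $\Pi=\operatorname{diag}(0,S)$, $\Phi=\operatorname{diag}(0,I_{n-r})$, $\Theta=\operatorname{diag}(L,0)$, $$\Lambda=\begin{bmatrix} \Lambda_{11}&\Lambda_{21}^{\mathsf T}&\Lambda_{31}^{\mathsf T}&\Lambda_{41}^{\mathsf T}&0\\ \Lambda_{21}&\Lambda_{22}&\Lambda_{32}^{\mathsf T}&\Lambda_{21}&B_{wd}\\ \Lambda_{31}&\Lambda_{32}&-\gamma^2I_p&\Lambda_{31}&D_w\\ \Lambda_{41}&\Lambda_{21}^{\mathsf T}&\Lambda_{31}^{\mathsf T}&-(Q+Q^{\mathsf T})&0\\ 0&B_{wd}^{\mathsf T}&D_w^{\mathsf T}&0&-I_q\end{bmatrix},$$ $\Lambda_{11}=-\tfrac12Q-\tfrac12Q^{\mathsf T}$, $\Lambda_{21}=A_d\Gamma^{\mathsf T}+B_{ud}Z^{\mathsf T}\Omega^{\mathsf T}$, $\Lambda_{31}=C_d\Gamma^{\mathsf T}$, $\Lambda_{41}=L-Q-\tfrac12Q^{\mathsf T}$, $\Lambda_{32}=C_d\Pi^{\mathsf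 T}$, $\Lambda_{22}=\Pi A_d^{\mathsf T}+A_d\Pi^{\mathsf T}+\Phi ZB_{ud}^{\mathsf T}+B_{ud}Z^{\mathsf T}\Phi^{\mathsf T}-\Theta$, $$M_2=\begin{bmatrix}0&(M_A^d)^{\mathsf T}&0&0&0\\0&0&M_C^{\mathsf T}&0&0\\0&(M_B^d)^{\mathsf T}&0&0&0\\0&0&M_D^{\mathsf T}&0&0\end{bmatrix},\qquad N_2=\begin{bmatrix}\Gamma(N_A^d)^{\mathsf T}&\Gamma(N_C^d)^{\mathsf T}&0&0\\\Pi(N_A^d)^{\mathsf T}&\Pi(N_C^d)^{\mathsf T}&0&0\\0&0&0&0\\\Gamma(N_A^d)^{\mathsf T}&\Gamma(N_C^d)^{\mathsf T}&0&0\\0&0&N_B^{\mathsf T}&N_D^{\mathsf T}\end{bmatrix}.$$ Then some gain $F\in\mathbb R^{m\times n}$ solves the robust $\mathcal H_\infty$ problem with level $\gamma$. Moreover $Q$ is invertible, and if $S$ is invertible, then the problem is solved by $$F=Z^{\mathsf T}\begin{bmatrix}Q^{-\mathsf T}&0\\-S^{-\mathsf T}R^{\mathsf T}Q^{-\mathsf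 T}&S^{-\mathsf T}\end{bmatrix}\overline V^{-1}.$$ If $S$ is not invertible, there is $\delta\in(0,1)$ such that $\bar S=S+\delta I_{n-r}$ is invertible, $(\ast)$ holds with $\bar S$ in place of $S$, and this formula with $\bar S$ in place of $S$ gives a gain that solves the problem. -/

import Mathlib

open scoped Matrix

noncomputable section

namespace Descriptor

/-! ### Descriptor systems `E x(k+1) = A x(k) + B w(k)`, `y(k) = C x(k) + D w(k)` -/

/-- The complex matrix `z E - A`. -/
def pencil {n : ℕ} (E A : Matrix (Fin n) (Fin n) ℝ) (z : ℂ) : Matrix (Fin n) (Fin n) ℂ :=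
  z • E.map Complex.ofReal - A.map Complex.ofReal

/-- The real polynomial `det (X E - A)`. -/
def pencilPoly {n : ℕ} (E A : Matrix (Fin n) (Fin n) ℝ) : Polynomial ℝ :=
  ((Polynomial.X : Polynomial ℝ) • E.map Polynomial.C - A.map Polynomial.C).det

/-- The pair `(E, A)` is admissible: regular, causal and stable. -/
structure IsAdmissible {n : ℕ} (E A : Matrix (Fin n) (Fin n) ℝ) : Prop where
  /-- `det (z E - A)` does not vanish identically -/
  regular : ∃ z : ℂ, (pencil E A z).det ≠ 0
  /-- `deg det (z E - A) = rank E` -/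
  causal : (pencilPoly E A).natDegree = E.rank
  /-- every finite generalized eigenvalue lies in the open unit disc -/
  stable : ∀ z : ℂ, (pencil E A z).det = 0 → ‖z‖ < 1

/-- The transfer function `P(z) = C (z E - A)⁻¹ B + D`. -/
def transferFunction {n p q : ℕ} (E A : Matrix (Fin n) (Fin n) ℝ)
    (B : Matrix (Fin n) (Fin q) ℝ) (C : Matrix (Fin p) (Fin n) ℝ) (D : Matrix (Fin p) (Fin q) ℝ)
    (z : ℂ) : Matrix (Fin p) (Fin q) ℂ :=
  C.map Complex.ofReal * (pencil E A z)⁻¹ * B.map Complex.ofReal + D.map Complex.ofReal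

/-- The maximal singular value of a matrix, that is, its operator norm for the Euclidean norms. -/
def sigmaMax {𝕜 : Type*} [RCLike 𝕜] {p q : ℕ} (M : Matrix (Fin p) (Fin q) 𝕜) : ℝ :=
  ‖LinearMap.toContinuousLinearMap (Matrix.toLpLin 2 2 M)‖

/-- The `H∞` norm: the supremum of the maximal singular value of `P(z)` over `|z| ≥ 1`, in
`[0, ∞]`. For the transfer function of an admissible system it is also the supremum over
`|z| > 1` and the supremum over `|z| = 1`. -/
def hInfNorm {p q : ℕ} (P : ℂ → Matrix (Fin p) (Fin q) ℂ) : ENNReal :=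
  ⨆ z : {z : ℂ // 1 ≤ ‖z‖}, ENNReal.ofReal (sigmaMax (P z))

/-! ### The uncertain system and its control problem -/

/-- The data of the uncertain system
`E x(k+1) = (A + M_A Δ N_A) x(k) + (B_w + M_B Δ N_B) w(k) + B_u u(k)`,
`y(k) = (C + M_C Δ N_C) x(k) + (D_w + M_D Δ N_D) w(k)`. -/
structure UncertainSystem (n m p q s : ℕ) where
  E : Matrix (Fin n) (Fin n) ℝ
  A : Matrix (Fin n) (Fin n) ℝ
  Bw : Matrix (Fin n) (Fin q) ℝ
  Bu : Matrix (Fin n) (Fin m) ℝ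
  C : Matrix (Fin p) (Fin n) ℝ
  Dw : Matrix (Fin p) (Fin q) ℝ
  MA : Matrix (Fin n) (Fin s) ℝ
  NA : Matrix (Fin s) (Fin n) ℝ
  MB : Matrix (Fin n) (Fin s) ℝ
  NB : Matrix (Fin s) (Fin q) ℝ
  MC : Matrix (Fin p) (Fin s) ℝ
  NC : Matrix (Fin s) (Fin n) ℝ
  MD : Matrix (Fin p) (Fin s) ℝ
  ND : Matrix (Fin s) (Fin q) ℝ

namespace UncertainSystem

variable {n m p q s : ℕ} (sys : UncertainSystem n m p q s)

/-- `A_Δ + B_u F`, the state matrix of the loop closed by `u = F x`. -/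
def closedA (F : Matrix (Fin m) (Fin n) ℝ) (Δ : Matrix (Fin s) (Fin s) ℝ) :
    Matrix (Fin n) (Fin n) ℝ :=
  (sys.A + sys.MA * Δ * sys.NA) + sys.Bu * F

/-- The closed-loop transfer function `C_Δ (z E - (A_Δ + B_u F))⁻¹ B_Δ + D_Δ`. -/
def closedTransfer (F : Matrix (Fin m) (Fin n) ℝ) (Δ : Matrix (Fin s) (Fin s) ℝ) :
    ℂ → Matrix (Fin p) (Fin q) ℂ :=
  transferFunction sys.E (sys.closedA F Δ) (sys.Bw + sys.MB * Δ * sys.NB)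
    (sys.C + sys.MC * Δ * sys.NC) (sys.Dw + sys.MD * Δ * sys.ND)

/-- The gain `F` solves the robust `H∞` control problem with level `γ`: for every `Δ` with
`‖Δ‖₂ ≤ 1` the closed loop is admissible and its `H∞` norm is less than `γ`. -/
def SolvedBy (γ : ℝ) (F : Matrix (Fin m) (Fin n) ℝ) : Prop :=
  ∀ Δ : Matrix (Fin s) (Fin s) ℝ, sigmaMax Δ ≤ 1 →
    IsAdmissible sys.E (sys.closedA F Δ) ∧
      hInfNorm (sys.closedTransfer F Δ) < ENNReal.ofReal γ

end UncertainSystem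

/-! ### Block matrices -/

/-- The splitting of `n` coordinates into the first `r` and the last `n - r`. -/
def split {r n : ℕ} (h : r ≤ n) : Fin r ⊕ Fin (n - r) ≃ Fin n :=
  finSumFinEquiv.trans (finCongr (Nat.add_sub_of_le h))

/-- The `n × n` matrix with blocks `[[X₁₁, X₁₂], [X₂₁, X₂₂]]`, where `X₁₁` is `r × r`. -/
def block {r n : ℕ} (h : r ≤ n) (X₁₁ : Matrix (Fin r) (Fin r) ℝ)
    (X₁₂ : Matrix (Fin r) (Fin (n - r)) ℝ) (X₂₁ : Matrix (Fin (n - r)) (Fin r) ℝ)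
    (X₂₂ : Matrix (Fin (n - r)) (Fin (n - r)) ℝ) : Matrix (Fin n) (Fin n) ℝ :=
  (Matrix.fromBlocks X₁₁ X₁₂ X₂₁ X₂₂).submatrix (split h).symm (split h).symm

/-- The `r × n` matrix `[X₁ X₂]`, where `X₁` is `r × r`. -/
def blockRow {r n : ℕ} (h : r ≤ n) (X₁ : Matrix (Fin r) (Fin r) ℝ)
    (X₂ : Matrix (Fin r) (Fin (n - r)) ℝ) : Matrix (Fin r) (Fin n) ℝ :=
  (Matrix.fromCols X₁ X₂).submatrix id (split h).symm

/-- A row of four blocks. -/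
def row4 {a b₁ b₂ b₃ b₄ : Type} (X₁ : Matrix a b₁ ℝ) (X₂ : Matrix a b₂ ℝ) (X₃ : Matrix a b₃ ℝ)
    (X₄ : Matrix a b₄ ℝ) : Matrix a (b₁ ⊕ b₂ ⊕ b₃ ⊕ b₄) ℝ :=
  Matrix.fromCols X₁ (Matrix.fromCols X₂ (Matrix.fromCols X₃ X₄))

/-- A row of five blocks. -/
def row5 {a b₁ b₂ b₃ b₄ b₅ : Type} (X₁ : Matrix a b₁ ℝ) (X₂ : Matrix a b₂ ℝ) (X₃ : Matrix a b₃ ℝ)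
    (X₄ : Matrix a b₄ ℝ) (X₅ : Matrix a b₅ ℝ) : Matrix a (b₁ ⊕ b₂ ⊕ b₃ ⊕ b₄ ⊕ b₅) ℝ :=
  Matrix.fromCols X₁ (row4 X₂ X₃ X₄ X₅)

/-- A column of four blocks. -/
def col4 {a₁ a₂ a₃ a₄ b : Type} (X₁ : Matrix a₁ b ℝ) (X₂ : Matrix a₂ b ℝ) (X₃ : Matrix a₃ b ℝ)
    (X₄ : Matrix a₄ b ℝ) : Matrix (a₁ ⊕ a₂ ⊕ a₃ ⊕ a₄) b ℝ :=
  Matrix.fromRows X₁ (Matrix.fromRows X₂ (Matrix.fromRows X₃ X₄))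

/-- A column of five blocks. -/
def col5 {a₁ a₂ a₃ a₄ a₅ b : Type} (X₁ : Matrix a₁ b ℝ) (X₂ : Matrix a₂ b ℝ) (X₃ : Matrix a₃ b ℝ)
    (X₄ : Matrix a₄ b ℝ) (X₅ : Matrix a₅ b ℝ) : Matrix (a₁ ⊕ a₂ ⊕ a₃ ⊕ a₄ ⊕ a₅) b ℝ :=
  Matrix.fromRows X₁ (col4 X₂ X₃ X₄ X₅)

/-! ### The linear matrix inequality -/

/-- The row index of `Λ`: blocks of sizes `r`, `n`, `p`, `r`, `q`. -/
abbrev LmiIdx (r n p q : ℕ) : Type := Fin r ⊕ Fin n ⊕ Fin p ⊕ Fin r ⊕ Fin q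

/-- Four blocks of size `s`. -/
abbrev UncIdx (s : ℕ) : Type := Fin s ⊕ Fin s ⊕ Fin s ⊕ Fin s

section LMI

variable {n m p q s r : ℕ} (h : r ≤ n) (sys : UncertainSystem n m p q s)
  (W V : Matrix (Fin n) (Fin n) ℝ)

/-- The pair `(W, V)` brings `E` to the form `diag (I_r, 0)`. -/
structure IsSVDTransform (E : Matrix (Fin n) (Fin n) ℝ) : Prop where
  left_nonsingular : IsUnit W.det
  right_nonsingular : IsUnit V.det
  normal_form : W * E * V = block h 1 0 0 0

/-- `Γ = [Q R]`. -/
def lmiGamma (Q : Matrix (Fin r) (Fin r) ℝ) (R : Matrix (Fin r) (Fin (n - r)) ℝ) :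
    Matrix (Fin r) (Fin n) ℝ := blockRow h Q R

/-- `Π = diag (0, S)`. -/
def lmiPi (S : Matrix (Fin (n - r)) (Fin (n - r)) ℝ) : Matrix (Fin n) (Fin n) ℝ :=
  block h 0 0 0 S

/-- `Θ = diag (L, 0)`. -/
def lmiTheta (L : Matrix (Fin r) (Fin r) ℝ) : Matrix (Fin n) (Fin n) ℝ := block h L 0 0 0

/-- `Φ = diag (0, I_{n-r})`. -/
def lmiPhi : Matrix (Fin n) (Fin n) ℝ := block h 0 0 0 1

/-- `Ω = [I_r 0]`. -/
def lmiOmega : Matrix (Fin r) (Fin n) ℝ := blockRow h 1 0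

/-- The matrix `Λ`. -/
def lmiLambda (γ : ℝ) (L Q : Matrix (Fin r) (Fin r) ℝ) (R : Matrix (Fin r) (Fin (n - r)) ℝ)
    (S : Matrix (Fin (n - r)) (Fin (n - r)) ℝ) (Z : Matrix (Fin n) (Fin m) ℝ) :
    Matrix (LmiIdx r n p q) (LmiIdx r n p q) ℝ :=
  let Ad := W * sys.A * V
  let Bwd := W * sys.Bw
  let Bud := W * sys.Bu
  let Cd := sys.C * V
  let Γ := lmiGamma h Q R
  let Pm := lmiPi h S
  let Φ : Matrix (Fin n) (Fin n) ℝ := lmiPhi h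
  let Ω : Matrix (Fin r) (Fin n) ℝ := lmiOmega h
  let Λ₁₁ := -(1 / 2 : ℝ) • Q - (1 / 2 : ℝ) • Qᵀ
  let Λ₂₁ := Ad * Γᵀ + Bud * Zᵀ * Ωᵀ
  let Λ₃₁ := Cd * Γᵀ
  let Λ₄₁ := L - Q - (1 / 2 : ℝ) • Qᵀ
  let Λ₂₂ := Pm * Adᵀ + Ad * Pmᵀ + Φ * Z * Budᵀ + Bud * Zᵀ * Φᵀ - lmiTheta h L
  let Λ₃₂ := Cd * Pmᵀ
  let Λ₅₂ := Bwdᵀ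
  let Λ₅₃ := sys.Dwᵀ
  col5
    (row5 Λ₁₁ Λ₂₁ᵀ Λ₃₁ᵀ Λ₄₁ᵀ 0)
    (row5 Λ₂₁ Λ₂₂ Λ₃₂ᵀ Λ₂₁ Λ₅₂ᵀ)
    (row5 Λ₃₁ Λ₃₂ ((-(γ ^ 2)) • (1 : Matrix (Fin p) (Fin p) ℝ)) Λ₃₁ Λ₅₃ᵀ)
    (row5 Λ₄₁ Λ₂₁ᵀ Λ₃₁ᵀ (-(Q + Qᵀ)) 0)
    (row5 0 Λ₅₂ Λ₅₃ 0 (-(1 : Matrix (Fin q) (Fin q) ℝ)))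

/-- The matrix `M₂`. -/
def lmiM₂ : Matrix (UncIdx s) (LmiIdx r n p q) ℝ :=
  let MAd := W * sys.MA
  let MBd := W * sys.MB
  let MCd := sys.MC
  col4
    (row5 0 MAdᵀ 0 0 0)
    (row5 0 0 MCdᵀ 0 0)
    (row5 0 MBdᵀ 0 0 0)
    (row5 0 0 sys.MDᵀ 0 0)

/-- The matrix `N₂`. -/
def lmiN₂ (Q : Matrix (Fin r) (Fin r) ℝ) (R : Matrix (Fin r) (Fin (n - r)) ℝ)
    (S : Matrix (Fin (n - r)) (Fin (n - r)) ℝ) : Matrix (LmiIdx r n p q) (UncIdx s) ℝ :=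
  let NAd := sys.NA * V
  let NBd := sys.NB
  let NCd := sys.NC * V
  let Γ := lmiGamma h Q R
  let Pm := lmiPi h S
  col5
    (row4 (Γ * NAdᵀ) (Γ * NCdᵀ) 0 0)
    (row4 (Pm * NAdᵀ) (Pm * NCdᵀ) 0 0)
    (row4 0 0 0 0)
    (row4 (Γ * NAdᵀ) (Γ * NCdᵀ) 0 0)
    (row4 0 0 NBdᵀ sys.NDᵀ)

/-- The inequality `[[Λ + ε M₂ᵀ M₂, N₂], [N₂ᵀ, -ε I_{4s}]] < 0`. -/
def LMI (γ : ℝ) (L Q : Matrix (Fin r) (Fin r) ℝ) (R : Matrix (Fin r) (Fin (n - r)) ℝ)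
    (S : Matrix (Fin (n - r)) (Fin (n - r)) ℝ) (Z : Matrix (Fin n) (Fin m) ℝ) (ε : ℝ) : Prop :=
  let M₂ : Matrix (UncIdx s) (LmiIdx r n p q) ℝ := lmiM₂ sys W
  let N₂ := lmiN₂ h sys V Q R S
  (-Matrix.fromBlocks (lmiLambda h sys W V γ L Q R S Z + ε • (M₂ᵀ * M₂)) N₂
      N₂ᵀ (-ε • (1 : Matrix (UncIdx s) (UncIdx s) ℝ))).PosDef

/-- The gain `F = Zᵀ [[Q⁻ᵀ, 0], [-S⁻ᵀ Rᵀ Q⁻ᵀ, S⁻ᵀ]] V⁻¹`. -/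
def gain (Q : Matrix (Fin r) (Fin r) ℝ) (R : Matrix (Fin r) (Fin (n - r)) ℝ)
    (S : Matrix (Fin (n - r)) (Fin (n - r)) ℝ) (Z : Matrix (Fin n) (Fin m) ℝ) :
    Matrix (Fin m) (Fin n) ℝ :=
  Zᵀ * block h (Qᵀ)⁻¹ 0 (-((Sᵀ)⁻¹ * Rᵀ * (Qᵀ)⁻¹)) (Sᵀ)⁻¹ * V⁻¹

end LMI

end Descriptor

end

noncomputable section

namespace Descriptor

open Matrix Filter Topology

/-! ### Uniform lower bounds and openness for positive definite real matrices -/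

section PosDef

variable {ι : Type*} [Fintype ι]

/-! The LMI is a bounded real inequality for the transposed closed loop, with the auxiliary matrices
and the uncertainty eliminated by a choice of test vectors.

Let `v = (a, η, u, c, w)` and pair it with `ζ = Δᵀ M₂ v` (blockwise). The `N₂` terms then turn the
nominal data into the perturbed data, and the remainder `ε (|M₂ v|² - |ζ|²)` is nonnegative because
`Δᵀ` is a contraction. The gain enters through `Ω Z = Γ (F V)ᵀ` and `Φ Z = Π (F V)ᵀ`, which turn
`A_Δ` into `A_Δ + B_u F` (`LMI.exists_closedLoop_le`). If the transposed equation gives `Ωᵀ b`, the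
choice `a = b`, `c = b / 2` removes `Q`, `R` and `S`, leaving a dissipation inequality with storage
`L` and a margin `κ` independent of `F` and `Δ` (`LMI.exists_dissipation`).

Applied to real and imaginary parts of `ξ (zE - A) = u C`, where `b = z Ω η`, the storage terms
contribute `(|z|² - 1) v* L v ≥ 0` with `v = Ω η`. For `|z| ≥ 1`, taking `u = 0` shows that the
pencil is nonsingular, and taking `ξ = u C (zE - A)⁻¹` bounds `|u P(z)|²` by `(γ² - κ) |u|²`.
Causality is the invertibility of the lower right block of the transformed state matrix: a kernel
vector of its transpose would contradict the LMI.

A singular `S` is handled by openness of the strict LMI, since `S + δ I` is singular for only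
finitely many `δ`. -/

theorem dotProduct_self_nonneg_real (x : ι → ℝ) : 0 ≤ x ⬝ᵥ x :=
  Finset.sum_nonneg fun i _ => mul_self_nonneg (x i)

theorem dotProduct_mulVec_comm {κ : Type*} [Fintype κ] (M : Matrix ι κ ℝ) (x : ι → ℝ) (y : κ → ℝ) :
    x ⬝ᵥ M *ᵥ y = y ⬝ᵥ Mᵀ *ᵥ x := by
  rw [dotProduct_mulVec, dotProduct_comm, mulVec_transpose]

theorem abs_dotProduct_mulVec_le (M : Matrix ι ι ℝ) (x : ι → ℝ) :
    |x ⬝ᵥ M *ᵥ x| ≤ (∑ i, ∑ j, |M i j|) * (x ⬝ᵥ x) := by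
  have hx : ∀ i j, |x i * x j| ≤ x ⬝ᵥ x := by
    intro i j
    have hk : ∀ k, x k * x k ≤ x ⬝ᵥ x := fun k =>
      Finset.single_le_sum (f := fun k => x k * x k) (fun k _ => mul_self_nonneg (x k))
        (Finset.mem_univ k)
    have h1 := hk i
    have h2 := hk j
    rw [abs_le]
    constructor <;> nlinarith [sq_nonneg (x i + x j), sq_nonneg (x i - x j)]
  have hexp : x ⬝ᵥ M *ᵥ x = ∑ i, ∑ j, x i * (M i j * x j) := by
    simp only [dotProduct, mulVec, Finset.mul_sum]
  rw [hexp, Finset.sum_mul]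
  refine (Finset.abs_sum_le_sum_abs _ _).trans (Finset.sum_le_sum fun i _ => ?_)
  rw [Finset.sum_mul]
  refine (Finset.abs_sum_le_sum_abs _ _).trans (Finset.sum_le_sum fun j _ => ?_)
  rw [mul_left_comm, abs_mul]
  exact mul_le_mul_of_nonneg_left (hx i j) (abs_nonneg _)

/-- The form attains a positive minimum on the compact unit sphere; homogeneity does the rest. -/
theorem exists_pos_mul_dotProduct_le {M : Matrix ι ι ℝ} (hM : M.PosDef) :
    ∃ κ : ℝ, 0 < κ ∧ ∀ x : ι → ℝ, κ * (x ⬝ᵥ x) ≤ x ⬝ᵥ M *ᵥ x := by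
  have hK : IsCompact {x : ι → ℝ | x ⬝ᵥ x = 1} := by
    refine Metric.isCompact_of_isClosed_isBounded ?_ ?_
    · exact isClosed_eq (by simp only [dotProduct]; fun_prop) continuous_const
    · refine (Metric.isBounded_closedBall (x := (0 : ι → ℝ)) (r := 1)).subset fun x hx => ?_
      rw [mem_closedBall_zero_iff, pi_norm_le_iff_of_nonneg zero_le_one]
      intro i
      have h1 : x i * x i ≤ x ⬝ᵥ x :=
        Finset.single_le_sum (f := fun k => x k * x k) (fun k _ => mul_self_nonneg (x k))
          (Finset.mem_univ i)
      rw [Set.mem_ofPred_eq.mp hx] at h1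
      rw [Real.norm_eq_abs, abs_le]
      constructor <;> nlinarith
  have hc : Continuous fun x : ι → ℝ => x ⬝ᵥ M *ᵥ x := by
    simp only [dotProduct, mulVec]; fun_prop
  -- The sphere is empty only when every vector is zero, and then any positive constant serves.
  rcases Set.eq_empty_or_nonempty {x : ι → ℝ | x ⬝ᵥ x = 1} with he | hne
  · refine ⟨1, one_pos, fun x => ?_⟩
    have hx : x ⬝ᵥ x = 0 := by
      by_contra h0
      have hpos : 0 < x ⬝ᵥ x := lt_of_le_of_ne (dotProduct_self_nonneg_real x) (Ne.symm h0)
      have : (Real.sqrt (x ⬝ᵥ x))⁻¹ • x ∈ {x : ι → ℝ | x ⬝ᵥ x = 1} := by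
        simp only [Set.mem_ofPred_eq, smul_dotProduct, dotProduct_smul, smul_eq_mul]
        rw [← mul_assoc, ← mul_inv, Real.mul_self_sqrt hpos.le, inv_mul_cancel₀ h0]
      rw [he] at this
      exact this
    have : x = 0 := by simpa using hx
    simp [this]
  · obtain ⟨x₀, hx₀, hmin⟩ := hK.exists_isMinOn hne hc.continuousOn
    refine ⟨x₀ ⬝ᵥ M *ᵥ x₀, ?_, fun x => ?_⟩
    · have : x₀ ≠ 0 := by
        rintro rfl
        simp at hx₀
      simpa using hM.dotProduct_mulVec_pos this
    · by_cases hx : x = 0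
      · simp [hx]
      have h0 : x ⬝ᵥ x ≠ 0 := by simpa using hx
      have hpos : 0 < x ⬝ᵥ x := lt_of_le_of_ne (dotProduct_self_nonneg_real x) (Ne.symm h0)
      have hmem : (Real.sqrt (x ⬝ᵥ x))⁻¹ • x ∈ {x : ι → ℝ | x ⬝ᵥ x = 1} := by
        simp only [Set.mem_ofPred_eq, smul_dotProduct, dotProduct_smul, smul_eq_mul]
        rw [← mul_assoc, ← mul_inv, Real.mul_self_sqrt hpos.le, inv_mul_cancel₀ h0]
      have h := isMinOn_iff.mp hmin _ hmem
      simp only [mulVec_smul, smul_dotProduct, dotProduct_smul, smul_eq_mul] at h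
      rw [← mul_assoc, ← mul_inv, Real.mul_self_sqrt hpos.le, ← div_eq_inv_mul,
        le_div_iff₀ hpos] at h
      exact h

/-- Near `0` the entries of `f t - f 0` have absolute sum below the coercivity constant of `f 0`, so
the change in the form cannot destroy positivity. -/
theorem eventually_posDef {f : ℝ → Matrix ι ι ℝ} (hf : Continuous f) (hs : ∀ t, (f t)ᵀ = f t)
    (h0 : (f 0).PosDef) : ∀ᶠ t in 𝓝 0, (f t).PosDef := by
  obtain ⟨κ, hκ, hle⟩ := exists_pos_mul_dotProduct_le h0
  have hc : Continuous fun t => ∑ i, ∑ j, |(f t - f 0) i j| := by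
    refine continuous_finsetSum _ fun i _ => continuous_finsetSum _ fun j _ => ?_
    exact ((hf.sub continuous_const).matrix_elem i j).abs
  have hlt : ∀ᶠ t in 𝓝 0, ∑ i, ∑ j, |(f t - f 0) i j| < κ :=
    hc.continuousAt.eventually_lt continuousAt_const (by simpa using hκ)
  filter_upwards [hlt] with t ht
  refine PosDef.of_dotProduct_mulVec_pos ?_ fun x hx => ?_
  · rw [IsHermitian, conjTranspose_eq_transpose_of_trivial, hs]
  have hne : x ⬝ᵥ x ≠ 0 := by simpa using hx
  have hpos : 0 < x ⬝ᵥ x := lt_of_le_of_ne (dotProduct_self_nonneg_real x) (Ne.symm hne)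
  have h1 := abs_le.mp (abs_dotProduct_mulVec_le (f t - f 0) x)
  have h2 := hle x
  rw [sub_mulVec, dotProduct_sub] at h1
  have h3 := mul_lt_mul_of_pos_right ht hpos
  simp only [star_trivial]
  linarith [h1.1]

theorem isUnit_det_of_dotProduct_mulVec_ne_zero [DecidableEq ι] {M : Matrix ι ι ℝ}
    (h : ∀ x : ι → ℝ, x ≠ 0 → x ⬝ᵥ M *ᵥ x ≠ 0) : IsUnit M.det := by
  rw [isUnit_iff_ne_zero]
  intro h0
  obtain ⟨x, hx, hMx⟩ := exists_mulVec_eq_zero_iff.mpr h0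
  exact h x hx (by simp [hMx])

end PosDef

/-! ### The quadratic form of the LMI, block by block -/

section Expansion

variable {n m p q s r : ℕ} (h : r ≤ n) (sys : UncertainSystem n m p q s)
  (W V : Matrix (Fin n) (Fin n) ℝ)

/-- The left-hand side of the linear matrix inequality. -/
def lmiMatrix (γ : ℝ) (L Q : Matrix (Fin r) (Fin r) ℝ) (R : Matrix (Fin r) (Fin (n - r)) ℝ)
    (S : Matrix (Fin (n - r)) (Fin (n - r)) ℝ) (Z : Matrix (Fin n) (Fin m) ℝ) (ε : ℝ) :
    Matrix (LmiIdx r n p q ⊕ UncIdx s) (LmiIdx r n p q ⊕ UncIdx s) ℝ :=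
  let M₂ : Matrix (UncIdx s) (LmiIdx r n p q) ℝ := lmiM₂ sys W
  let N₂ := lmiN₂ h sys V Q R S
  Matrix.fromBlocks (lmiLambda h sys W V γ L Q R S Z + ε • (M₂ᵀ * M₂)) N₂
      N₂ᵀ (-ε • (1 : Matrix (UncIdx s) (UncIdx s) ℝ))

theorem LMI_iff (γ : ℝ) (L Q : Matrix (Fin r) (Fin r) ℝ) (R : Matrix (Fin r) (Fin (n - r)) ℝ)
    (S : Matrix (Fin (n - r)) (Fin (n - r)) ℝ) (Z : Matrix (Fin n) (Fin m) ℝ) (ε : ℝ) :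
    LMI h sys W V γ L Q R S Z ε ↔ (-lmiMatrix h sys W V γ L Q R S Z ε).PosDef := Iff.rfl

/-- A column vector made of five blocks. -/
def vec5 {r n p q : ℕ} (a : Fin r → ℝ) (η : Fin n → ℝ) (u : Fin p → ℝ) (c : Fin r → ℝ)
    (w : Fin q → ℝ) : LmiIdx r n p q → ℝ :=
  Sum.elim a (Sum.elim η (Sum.elim u (Sum.elim c w)))

/-- A column vector made of four blocks. -/
def vec4 {s : ℕ} (ζ₁ ζ₂ ζ₃ ζ₄ : Fin s → ℝ) : UncIdx s → ℝ :=
  Sum.elim ζ₁ (Sum.elim ζ₂ (Sum.elim ζ₃ ζ₄))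

theorem lmiM₂_mulVec (a : Fin r → ℝ) (η : Fin n → ℝ) (u : Fin p → ℝ) (c : Fin r → ℝ)
    (w : Fin q → ℝ) :
    lmiM₂ sys W *ᵥ vec5 a η u c w =
      vec4 ((W * sys.MA)ᵀ *ᵥ η) (sys.MCᵀ *ᵥ u) ((W * sys.MB)ᵀ *ᵥ η) (sys.MDᵀ *ᵥ u) := by
  simp only [lmiM₂, vec5, vec4, col4, row5, row4, fromRows_mulVec, fromCols_mulVec,
    Sum.elim_comp_inl, Sum.elim_comp_inr, zero_mulVec, zero_add, add_zero]

theorem dotProduct_lmiN₂_mulVec (Q : Matrix (Fin r) (Fin r) ℝ)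
    (R : Matrix (Fin r) (Fin (n - r)) ℝ) (S : Matrix (Fin (n - r)) (Fin (n - r)) ℝ)
    (a : Fin r → ℝ) (η : Fin n → ℝ) (u : Fin p → ℝ) (c : Fin r → ℝ)
    (w : Fin q → ℝ) (ζ₁ ζ₂ ζ₃ ζ₄ : Fin s → ℝ) :
    vec5 a η u c w ⬝ᵥ lmiN₂ h sys V Q R S *ᵥ vec4 ζ₁ ζ₂ ζ₃ ζ₄ =
      (a + c) ⬝ᵥ lmiGamma h Q R *ᵥ ((sys.NA * V)ᵀ *ᵥ ζ₁ + (sys.NC * V)ᵀ *ᵥ ζ₂) +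
      η ⬝ᵥ lmiPi h S *ᵥ ((sys.NA * V)ᵀ *ᵥ ζ₁ + (sys.NC * V)ᵀ *ᵥ ζ₂) +
      w ⬝ᵥ (sys.NBᵀ *ᵥ ζ₃ + sys.NDᵀ *ᵥ ζ₄) := by
  simp only [lmiN₂, vec5, vec4, col5, col4, row4, fromRows_mulVec, fromCols_mulVec,
    Sum.elim_comp_inl, Sum.elim_comp_inr, zero_mulVec, zero_add, add_zero,
    sumElim_dotProduct_sumElim, mulVec_add, mulVec_mulVec, dotProduct_add, add_dotProduct,
    dotProduct_zero]
  ring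

theorem dotProduct_col5_mulVec (Λ₁₁ Λ₄₁ Λ₄₄ : Matrix (Fin r) (Fin r) ℝ)
    (Λ₂₁ : Matrix (Fin n) (Fin r) ℝ) (Λ₃₁ : Matrix (Fin p) (Fin r) ℝ)
    (Λ₂₂ : Matrix (Fin n) (Fin n) ℝ) (Λ₃₂ : Matrix (Fin p) (Fin n) ℝ)
    (Λ₅₂ : Matrix (Fin q) (Fin n) ℝ) (Λ₃₃ : Matrix (Fin p) (Fin p) ℝ)
    (Λ₅₃ : Matrix (Fin q) (Fin p) ℝ) (Λ₅₅ : Matrix (Fin q) (Fin q) ℝ)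
    (a : Fin r → ℝ) (η : Fin n → ℝ) (u : Fin p → ℝ) (c : Fin r → ℝ) (w : Fin q → ℝ) :
    vec5 a η u c w ⬝ᵥ col5
      (row5 Λ₁₁ Λ₂₁ᵀ Λ₃₁ᵀ Λ₄₁ᵀ 0)
      (row5 Λ₂₁ Λ₂₂ Λ₃₂ᵀ Λ₂₁ Λ₅₂ᵀ)
      (row5 Λ₃₁ Λ₃₂ Λ₃₃ Λ₃₁ Λ₅₃ᵀ)
      (row5 Λ₄₁ Λ₂₁ᵀ Λ₃₁ᵀ Λ₄₄ 0)
      (row5 0 Λ₅₂ Λ₅₃ 0 Λ₅₅) *ᵥ vec5 a η u c w =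
    a ⬝ᵥ Λ₁₁ *ᵥ a + 2 * (a ⬝ᵥ Λ₂₁ᵀ *ᵥ η) + 2 * (c ⬝ᵥ Λ₂₁ᵀ *ᵥ η) + 2 * (a ⬝ᵥ Λ₃₁ᵀ *ᵥ u)
      + 2 * (c ⬝ᵥ Λ₃₁ᵀ *ᵥ u) + 2 * (c ⬝ᵥ Λ₄₁ *ᵥ a) + η ⬝ᵥ Λ₂₂ *ᵥ η + 2 * (η ⬝ᵥ Λ₃₂ᵀ *ᵥ u)
      + 2 * (w ⬝ᵥ Λ₅₂ *ᵥ η) + u ⬝ᵥ Λ₃₃ *ᵥ u + 2 * (w ⬝ᵥ Λ₅₃ *ᵥ u) + c ⬝ᵥ Λ₄₄ *ᵥ c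
      + w ⬝ᵥ Λ₅₅ *ᵥ w := by
  simp only [vec5, col5, col4, row5, row4, fromRows_mulVec, fromCols_mulVec,
    Sum.elim_comp_inl, Sum.elim_comp_inr, zero_mulVec, zero_add, add_zero,
    sumElim_dotProduct_sumElim, dotProduct_add]
  rw [dotProduct_mulVec_comm Λ₂₁ η a, dotProduct_mulVec_comm Λ₂₁ η c,
    dotProduct_mulVec_comm Λ₃₁ u a, dotProduct_mulVec_comm Λ₃₁ u c,
    dotProduct_mulVec_comm Λ₄₁ c a, dotProduct_mulVec_comm Λ₃₂ u η,
    dotProduct_mulVec_comm Λ₅₂ w η, dotProduct_mulVec_comm Λ₅₃ w u]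
  ring

/-- Grouped so that `a` and `c` meet the system data only through `a + c`, and `Z` occurs only as `Ω
Z` and `Φ Z`, the two products that the gain equations rewrite. -/
theorem dotProduct_lmiLambda_mulVec (γ : ℝ) (L Q : Matrix (Fin r) (Fin r) ℝ)
    (R : Matrix (Fin r) (Fin (n - r)) ℝ)
    (S : Matrix (Fin (n - r)) (Fin (n - r)) ℝ) (Z : Matrix (Fin n) (Fin m) ℝ)
    (a : Fin r → ℝ) (η : Fin n → ℝ) (u : Fin p → ℝ) (c : Fin r → ℝ) (w : Fin q → ℝ) :
    vec5 a η u c w ⬝ᵥ lmiLambda h sys W V γ L Q R S Z *ᵥ vec5 a η u c w =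
      -(a ⬝ᵥ Q *ᵥ a) + 2 * (c ⬝ᵥ L *ᵥ a - c ⬝ᵥ Q *ᵥ a) - a ⬝ᵥ Q *ᵥ c - 2 * (c ⬝ᵥ Q *ᵥ c)
      + 2 * ((a + c) ⬝ᵥ (lmiGamma h Q R *ᵥ ((W * sys.A * V)ᵀ *ᵥ η + (sys.C * V)ᵀ *ᵥ u)
          + (lmiOmega h * Z) *ᵥ (W * sys.Bu)ᵀ *ᵥ η))
      + 2 * (η ⬝ᵥ (lmiPi h S *ᵥ ((W * sys.A * V)ᵀ *ᵥ η + (sys.C * V)ᵀ *ᵥ u)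
          + (lmiPhi h * Z) *ᵥ (W * sys.Bu)ᵀ *ᵥ η))
      - η ⬝ᵥ lmiTheta h L *ᵥ η - γ ^ 2 * (u ⬝ᵥ u)
      + 2 * (w ⬝ᵥ ((W * sys.Bw)ᵀ *ᵥ η + sys.Dwᵀ *ᵥ u)) - w ⬝ᵥ w := by
  have h₁ : c ⬝ᵥ Qᵀ *ᵥ a = a ⬝ᵥ Q *ᵥ c := (dotProduct_mulVec_comm Q a c).symm
  have h₂ : a ⬝ᵥ Qᵀ *ᵥ a = a ⬝ᵥ Q *ᵥ a := (dotProduct_mulVec_comm Q a a).symm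
  have h₃ : c ⬝ᵥ Qᵀ *ᵥ c = c ⬝ᵥ Q *ᵥ c := (dotProduct_mulVec_comm Q c c).symm
  simp only [lmiLambda]
  generalize W * sys.A * V = Ad, W * sys.Bu = Bu, sys.C * V = Cd, W * sys.Bw = Bw
  have h₄ : η ⬝ᵥ (Ad * (lmiPi h S)ᵀ) *ᵥ η = η ⬝ᵥ (lmiPi h S * Adᵀ) *ᵥ η := by
    rw [dotProduct_mulVec_comm, transpose_mul, transpose_transpose]
  have h₅ : η ⬝ᵥ (Bu * (Zᵀ * (lmiPhi h)ᵀ)) *ᵥ η = η ⬝ᵥ (lmiPhi h * (Z * Buᵀ)) *ᵥ η := by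
    rw [dotProduct_mulVec_comm]
    simp only [transpose_mul, transpose_transpose, Matrix.mul_assoc]
  rw [dotProduct_col5_mulVec]
  simp only [add_mulVec, sub_mulVec, smul_mulVec, neg_mulVec, one_mulVec, dotProduct_add,
    dotProduct_sub, dotProduct_neg, dotProduct_smul, smul_eq_mul, h₁, h₂, h₃, h₄, h₅,
    neg_smul, transpose_add, transpose_mul, transpose_transpose,
    add_dotProduct, mulVec_add, mulVec_mulVec, Matrix.mul_assoc]
  ring

end Expansion

/-! ### Elimination of the uncertainty and the real dissipation inequality -/

section ClosedLoop

variable {n m p q s r : ℕ} (h : r ≤ n) (sys : UncertainSystem n m p q s)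
  (W V : Matrix (Fin n) (Fin n) ℝ) {γ : ℝ} {L Q : Matrix (Fin r) (Fin r) ℝ}
  {R : Matrix (Fin r) (Fin (n - r)) ℝ} {S : Matrix (Fin (n - r)) (Fin (n - r)) ℝ}
  {Z : Matrix (Fin n) (Fin m) ℝ} {ε : ℝ}

theorem dotProduct_self_eq_norm_sq {k : ℕ} (x : Fin k → ℝ) : x ⬝ᵥ x = ‖WithLp.toLp 2 x‖ ^ 2 := by
  rw [EuclideanSpace.real_norm_sq_eq]
  simp [dotProduct, sq]

theorem norm_toLp_mulVec_le {𝕜 : Type*} [RCLike 𝕜] {k l : ℕ} (M : Matrix (Fin k) (Fin l) 𝕜)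
    (x : Fin l → 𝕜) :
    ‖WithLp.toLp 2 (M *ᵥ x)‖ ≤ sigmaMax M * ‖WithLp.toLp 2 x‖ := by
  have := (LinearMap.toContinuousLinearMap (Matrix.toLpLin 2 2 M)).le_opNorm (WithLp.toLp 2 x)
  simpa [sigmaMax, toLpLin_apply] using this

/-- By Cauchy–Schwarz, `|Δᵀx|² = x · ΔΔᵀx ≤ |x| |ΔΔᵀx| ≤ |x| |Δᵀx|`. -/
theorem dotProduct_transpose_mulVec_self_le {Δ : Matrix (Fin s) (Fin s) ℝ} (hΔ : sigmaMax Δ ≤ 1)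
    (x : Fin s → ℝ) : (Δᵀ *ᵥ x) ⬝ᵥ (Δᵀ *ᵥ x) ≤ x ⬝ᵥ x := by
  have h1 : (Δᵀ *ᵥ x) ⬝ᵥ (Δᵀ *ᵥ x) = x ⬝ᵥ Δ *ᵥ (Δᵀ *ᵥ x) :=
    (dotProduct_mulVec_comm Δ x (Δᵀ *ᵥ x)).symm
  have h2 : x ⬝ᵥ Δ *ᵥ (Δᵀ *ᵥ x) ≤ ‖WithLp.toLp 2 x‖ * ‖WithLp.toLp 2 (Δ *ᵥ (Δᵀ *ᵥ x))‖ := by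
    have := real_inner_le_norm (WithLp.toLp 2 x) (WithLp.toLp 2 (Δ *ᵥ (Δᵀ *ᵥ x)))
    rwa [EuclideanSpace.inner_eq_star_dotProduct, star_trivial, dotProduct_comm] at this
  have h3 := norm_toLp_mulVec_le Δ (Δᵀ *ᵥ x)
  have h4 : sigmaMax Δ * ‖WithLp.toLp 2 (Δᵀ *ᵥ x)‖ ≤ ‖WithLp.toLp 2 (Δᵀ *ᵥ x)‖ :=
    mul_le_of_le_one_left (norm_nonneg _) hΔ
  have h5 := mul_le_mul_of_nonneg_left (h3.trans h4) (norm_nonneg (WithLp.toLp 2 x))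
  rw [dotProduct_self_eq_norm_sq] at h1 ⊢
  rw [dotProduct_self_eq_norm_sq]
  nlinarith [norm_nonneg (WithLp.toLp 2 x), norm_nonneg (WithLp.toLp 2 (Δᵀ *ᵥ x))]

theorem dotProduct_lmiMatrix_mulVec (v : LmiIdx r n p q → ℝ) (ζ : UncIdx s → ℝ) :
    Sum.elim v ζ ⬝ᵥ lmiMatrix h sys W V γ L Q R S Z ε *ᵥ Sum.elim v ζ =
      v ⬝ᵥ lmiLambda h sys W V γ L Q R S Z *ᵥ v + 2 * (v ⬝ᵥ lmiN₂ h sys V Q R S *ᵥ ζ)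
        + ε * ((lmiM₂ sys W *ᵥ v) ⬝ᵥ (lmiM₂ sys W *ᵥ v) - ζ ⬝ᵥ ζ) := by
  have h1 : v ⬝ᵥ (lmiM₂ (r := r) sys W)ᵀ *ᵥ (lmiM₂ sys W *ᵥ v) =
      (lmiM₂ sys W *ᵥ v) ⬝ᵥ (lmiM₂ sys W *ᵥ v) := by
    rw [dotProduct_mulVec_comm, transpose_transpose]
  simp only [lmiMatrix, fromBlocks_mulVec, Sum.elim_comp_inl, Sum.elim_comp_inr,
    sumElim_dotProduct_sumElim, add_mulVec, smul_mulVec, neg_mulVec, one_mulVec, neg_smul,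
    dotProduct_add, dotProduct_smul, dotProduct_neg, smul_eq_mul, ← mulVec_mulVec, h1]
  rw [← dotProduct_mulVec_comm (lmiN₂ h sys V Q R S) v ζ]
  ring

/-- The quadratic inequality for the loop closed by `u = F x` under the uncertainty `Δ`. -/
theorem LMI.exists_closedLoop_le (hε : 0 < ε) (hLMI : LMI h sys W V γ L Q R S Z ε) :
    ∃ κ : ℝ, 0 < κ ∧ ∀ (F : Matrix (Fin m) (Fin n) ℝ) (Δ : Matrix (Fin s) (Fin s) ℝ),
      lmiOmega h * Z = lmiGamma h Q R * (F * V)ᵀ → lmiPhi h * Z = lmiPi h S * (F * V)ᵀ →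
      sigmaMax Δ ≤ 1 → ∀ (a : Fin r → ℝ) (η : Fin n → ℝ) (u : Fin p → ℝ) (c : Fin r → ℝ)
        (w : Fin q → ℝ),
      -(a ⬝ᵥ Q *ᵥ a) + 2 * (c ⬝ᵥ L *ᵥ a - c ⬝ᵥ Q *ᵥ a) - a ⬝ᵥ Q *ᵥ c - 2 * (c ⬝ᵥ Q *ᵥ c)
      + 2 * ((a + c) ⬝ᵥ lmiGamma h Q R *ᵥ ((W * sys.closedA F Δ * V)ᵀ *ᵥ η
          + ((sys.C + sys.MC * Δ * sys.NC) * V)ᵀ *ᵥ u))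
      + 2 * (η ⬝ᵥ lmiPi h S *ᵥ ((W * sys.closedA F Δ * V)ᵀ *ᵥ η
          + ((sys.C + sys.MC * Δ * sys.NC) * V)ᵀ *ᵥ u))
      - η ⬝ᵥ lmiTheta h L *ᵥ η - γ ^ 2 * (u ⬝ᵥ u)
      + 2 * (w ⬝ᵥ ((W * (sys.Bw + sys.MB * Δ * sys.NB))ᵀ *ᵥ η
          + (sys.Dw + sys.MD * Δ * sys.ND)ᵀ *ᵥ u)) - w ⬝ᵥ w
      ≤ -κ * (η ⬝ᵥ η + u ⬝ᵥ u) := by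
  obtain ⟨κ, hκ, hle⟩ := exists_pos_mul_dotProduct_le ((LMI_iff _ _ _ _ _ _ _ _ _ _ _).mp hLMI)
  refine ⟨κ, hκ, fun F Δ hΩ hΦ hΔ a η u c w => ?_⟩
  -- The second component is `Δᵀ` applied to each block of `M₂ v`: its cross terms with `N₂` are
  -- exactly the uncertain parts of the closed-loop matrices.
  have hmain := hle (Sum.elim (vec5 a η u c w) (vec4 (Δᵀ *ᵥ (W * sys.MA)ᵀ *ᵥ η)
    (Δᵀ *ᵥ sys.MCᵀ *ᵥ u) (Δᵀ *ᵥ (W * sys.MB)ᵀ *ᵥ η) (Δᵀ *ᵥ sys.MDᵀ *ᵥ u)))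
  rw [neg_mulVec, dotProduct_neg, dotProduct_lmiMatrix_mulVec, lmiM₂_mulVec,
    dotProduct_lmiN₂_mulVec, dotProduct_lmiLambda_mulVec, hΩ, hΦ] at hmain
  have hA : (W * sys.closedA F Δ * V)ᵀ *ᵥ η + ((sys.C + sys.MC * Δ * sys.NC) * V)ᵀ *ᵥ u =
      ((W * sys.A * V)ᵀ *ᵥ η + (sys.C * V)ᵀ *ᵥ u) + (F * V)ᵀ *ᵥ (W * sys.Bu)ᵀ *ᵥ η
        + ((sys.NA * V)ᵀ *ᵥ Δᵀ *ᵥ (W * sys.MA)ᵀ *ᵥ η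
          + (sys.NC * V)ᵀ *ᵥ Δᵀ *ᵥ sys.MCᵀ *ᵥ u) := by
    simp only [UncertainSystem.closedA, Matrix.mul_add, Matrix.add_mul, transpose_add,
      transpose_mul, add_mulVec, mulVec_mulVec, Matrix.mul_assoc]
    abel
  have hB : (W * (sys.Bw + sys.MB * Δ * sys.NB))ᵀ *ᵥ η
        + (sys.Dw + sys.MD * Δ * sys.ND)ᵀ *ᵥ u =
      ((W * sys.Bw)ᵀ *ᵥ η + sys.Dwᵀ *ᵥ u) + (sys.NBᵀ *ᵥ Δᵀ *ᵥ (W * sys.MB)ᵀ *ᵥ η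
        + sys.NDᵀ *ᵥ Δᵀ *ᵥ sys.MDᵀ *ᵥ u) := by
    simp only [Matrix.mul_add, transpose_add,
      transpose_mul, add_mulVec, mulVec_mulVec, Matrix.mul_assoc]
    abel
  rw [hA, hB]
  have d₁ := dotProduct_transpose_mulVec_self_le hΔ ((W * sys.MA)ᵀ *ᵥ η)
  have d₂ := dotProduct_transpose_mulVec_self_le hΔ (sys.MCᵀ *ᵥ u)
  have d₃ := dotProduct_transpose_mulVec_self_le hΔ ((W * sys.MB)ᵀ *ᵥ η)
  have d₄ := dotProduct_transpose_mulVec_self_le hΔ (sys.MDᵀ *ᵥ u)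
  generalize (W * sys.MA)ᵀ *ᵥ η = x₁, sys.MCᵀ *ᵥ u = x₂, (W * sys.MB)ᵀ *ᵥ η = x₃,
    sys.MDᵀ *ᵥ u = x₄ at *
  generalize Δᵀ *ᵥ x₁ = y₁, Δᵀ *ᵥ x₂ = y₂, Δᵀ *ᵥ x₃ = y₃, Δᵀ *ᵥ x₄ = y₄ at *
  generalize (sys.NA * V)ᵀ *ᵥ y₁ + (sys.NC * V)ᵀ *ᵥ y₂ = e at *
  generalize (W * sys.A * V)ᵀ *ᵥ η + (sys.C * V)ᵀ *ᵥ u = f at *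
  generalize sys.NBᵀ *ᵥ y₃ + sys.NDᵀ *ᵥ y₄ = g at *
  generalize (W * sys.Bw)ᵀ *ᵥ η + sys.Dwᵀ *ᵥ u = k at *
  simp only [vec5, vec4, sumElim_dotProduct_sumElim, mulVec_add, ← mulVec_mulVec,
    dotProduct_add, add_dotProduct] at hmain ⊢
  have hε₁ := mul_nonneg hε.le (sub_nonneg.mpr d₁)
  have hε₂ := mul_nonneg hε.le (sub_nonneg.mpr d₂)
  have hε₃ := mul_nonneg hε.le (sub_nonneg.mpr d₃)
  have hε₄ := mul_nonneg hε.le (sub_nonneg.mpr d₄)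
  -- Of the margin `κ |(v, ζ)|²` only the parts in `η` and `u` are kept.
  have n₁ := mul_nonneg hκ.le (dotProduct_self_nonneg_real a)
  have n₂ := mul_nonneg hκ.le (dotProduct_self_nonneg_real c)
  have n₃ := mul_nonneg hκ.le (dotProduct_self_nonneg_real w)
  have n₄ := mul_nonneg hκ.le (dotProduct_self_nonneg_real y₁)
  have n₅ := mul_nonneg hκ.le (dotProduct_self_nonneg_real y₂)
  have n₆ := mul_nonneg hκ.le (dotProduct_self_nonneg_real y₃)
  have n₇ := mul_nonneg hκ.le (dotProduct_self_nonneg_real y₄)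
  linarith

/-- On vectors supported in the fourth block the form is `-2 x · Qx`, which must be negative for `x
≠ 0`. -/
theorem LMI.isUnit_det (hLMI : LMI h sys W V γ L Q R S Z ε) : IsUnit Q.det := by
  obtain ⟨κ, hκ, hle⟩ := exists_pos_mul_dotProduct_le ((LMI_iff _ _ _ _ _ _ _ _ _ _ _).mp hLMI)
  refine isUnit_det_of_dotProduct_mulVec_ne_zero fun x hx h0 => ?_
  have hmain := hle (Sum.elim (vec5 0 0 0 x 0) (vec4 0 0 0 0))
  rw [neg_mulVec, dotProduct_neg, dotProduct_lmiMatrix_mulVec, lmiM₂_mulVec,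
    dotProduct_lmiN₂_mulVec, dotProduct_lmiLambda_mulVec] at hmain
  simp [vec5, vec4, sumElim_dotProduct_sumElim, h0] at hmain
  have h1 : x ⬝ᵥ x ≠ 0 := by simpa using hx
  have h2 : 0 < x ⬝ᵥ x := lt_of_le_of_ne (dotProduct_self_nonneg_real x) (Ne.symm h1)
  nlinarith

/-- With `a = b` and `c = b / 2` all terms in `Q` cancel. -/
theorem LMI.exists_dissipation (hε : 0 < ε) (hLMI : LMI h sys W V γ L Q R S Z ε) :
    ∃ κ : ℝ, 0 < κ ∧ ∀ (F : Matrix (Fin m) (Fin n) ℝ) (Δ : Matrix (Fin s) (Fin s) ℝ),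
      lmiOmega h * Z = lmiGamma h Q R * (F * V)ᵀ → lmiPhi h * Z = lmiPi h S * (F * V)ᵀ →
      sigmaMax Δ ≤ 1 → ∀ (η : Fin n → ℝ) (u : Fin p → ℝ) (b : Fin r → ℝ) (y : Fin q → ℝ),
      (W * sys.closedA F Δ * V)ᵀ *ᵥ η + ((sys.C + sys.MC * Δ * sys.NC) * V)ᵀ *ᵥ u =
        (lmiOmega h)ᵀ *ᵥ b →
      (W * (sys.Bw + sys.MB * Δ * sys.NB))ᵀ *ᵥ η + (sys.Dw + sys.MD * Δ * sys.ND)ᵀ *ᵥ u = y →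
      b ⬝ᵥ L *ᵥ b - η ⬝ᵥ lmiTheta h L *ᵥ η + y ⬝ᵥ y ≤
        γ ^ 2 * (u ⬝ᵥ u) - κ * (η ⬝ᵥ η + u ⬝ᵥ u) := by
  obtain ⟨κ, hκ, hle⟩ := hLMI.exists_closedLoop_le h sys W V hε
  refine ⟨κ, hκ, fun F Δ hΩ hΦ hΔ η u b y hb hy => ?_⟩
  -- The coefficients of `b · Qb` are `-1, -1, -1/2, -1/2` and, from `2 (a + c) = 3 b`, `+3`. The
  -- choice `w = y` maximizes `2 w · y - w · w`, with value `y · y`.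
  have hmain := hle F Δ hΩ hΦ hΔ b η u ((1 / 2 : ℝ) • b) y
  have hΓ : lmiGamma h Q R * (lmiOmega h)ᵀ = Q := by
    simp [lmiGamma, lmiOmega, blockRow, transpose_submatrix, submatrix_mul_equiv,
      transpose_fromCols, fromCols_mul_fromRows]
  have hP : lmiPi h S * (lmiOmega h)ᵀ = 0 := by
    simp [lmiPi, block, lmiOmega, blockRow, transpose_submatrix, submatrix_mul_equiv,
      transpose_fromCols, fromBlocks_mul_fromRows]
  rw [hb, hy, mulVec_mulVec, mulVec_mulVec, hΓ, hP] at hmain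
  simp only [add_dotProduct, smul_dotProduct, mulVec_smul, dotProduct_smul, smul_eq_mul,
    zero_mulVec, dotProduct_zero] at hmain
  linarith

end ClosedLoop

/-! ### The dissipation inequality at a complex frequency -/

section Complex

variable {n m p q s r : ℕ} (h : r ≤ n) (sys : UncertainSystem n m p q s)
  (W V : Matrix (Fin n) (Fin n) ℝ) {γ : ℝ} {L Q : Matrix (Fin r) (Fin r) ℝ}
  {R : Matrix (Fin r) (Fin (n - r)) ℝ} {S : Matrix (Fin (n - r)) (Fin (n - r)) ℝ}
  {Z : Matrix (Fin n) (Fin m) ℝ} {ε : ℝ}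

/-- The real part of a complex vector. -/
def reVec {k : ℕ} (v : Fin k → ℂ) : Fin k → ℝ := fun i => (v i).re

/-- The imaginary part of a complex vector. -/
def imVec {k : ℕ} (v : Fin k → ℂ) : Fin k → ℝ := fun i => (v i).im

theorem reVec_vecMul {k l : ℕ} (M : Matrix (Fin k) (Fin l) ℝ) (v : Fin k → ℂ) :
    reVec (v ᵥ* M.map Complex.ofReal) = Mᵀ *ᵥ reVec v := by
  ext i
  simp [reVec, vecMul, mulVec, dotProduct, mul_comm]

theorem imVec_vecMul {k l : ℕ} (M : Matrix (Fin k) (Fin l) ℝ) (v : Fin k → ℂ) :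
    imVec (v ᵥ* M.map Complex.ofReal) = Mᵀ *ᵥ imVec v := by
  ext i
  simp [imVec, vecMul, mulVec, dotProduct, mul_comm]

theorem reVec_add {k : ℕ} (v w : Fin k → ℂ) : reVec (v + w) = reVec v + reVec w := rfl

theorem imVec_add {k : ℕ} (v w : Fin k → ℂ) : imVec (v + w) = imVec v + imVec w := rfl

theorem reVec_smul {k : ℕ} (z : ℂ) (v : Fin k → ℂ) :
    reVec (z • v) = z.re • reVec v - z.im • imVec v := by
  ext i
  simp [reVec, imVec]

theorem imVec_smul {k : ℕ} (z : ℂ) (v : Fin k → ℂ) :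
    imVec (z • v) = z.re • imVec v + z.im • reVec v := by
  ext i
  simp [reVec, imVec]

theorem norm_sq_eq_reVec_add_imVec {k : ℕ} (v : Fin k → ℂ) :
    ‖WithLp.toLp 2 v‖ ^ 2 = reVec v ⬝ᵥ reVec v + imVec v ⬝ᵥ imVec v := by
  rw [EuclideanSpace.norm_sq_eq]
  simp [reVec, imVec, dotProduct, ← Finset.sum_add_distrib, Complex.sq_norm, Complex.normSq_apply]

theorem map_ofReal_mul {k l t : ℕ} (M : Matrix (Fin k) (Fin l) ℝ) (N : Matrix (Fin l) (Fin t) ℝ) :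
    (M * N).map Complex.ofReal = M.map Complex.ofReal * N.map Complex.ofReal :=
  Matrix.map_mul (f := Complex.ofRealHom)

theorem pencil_mul_mul (E A : Matrix (Fin n) (Fin n) ℝ) (z : ℂ) :
    pencil (W * E * V) (W * A * V) z =
      W.map Complex.ofReal * pencil E A z * V.map Complex.ofReal := by
  simp only [pencil, map_ofReal_mul, Matrix.mul_sub, Matrix.sub_mul, Matrix.mul_smul,
    Matrix.smul_mul]

theorem lmiTheta_eq (L : Matrix (Fin r) (Fin r) ℝ) :
    lmiTheta h L = (lmiOmega h)ᵀ * L * lmiOmega h := by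
  have : L = L.submatrix id id := rfl
  rw [lmiTheta, lmiOmega, blockRow, transpose_submatrix, transpose_fromCols, block, this,
    ← submatrix_mul _ _ _ id _ Function.bijective_id,
    ← submatrix_mul _ _ _ id _ Function.bijective_id]
  congr 1
  simp only [fromRows_mul, mul_fromCols, transpose_one, transpose_zero, Matrix.one_mul,
    Matrix.zero_mul, Matrix.mul_one, Matrix.mul_zero]
  ext (i | i) (j | j) <;> rfl

theorem block_one_zero :
    (block h 1 0 0 0 : Matrix (Fin n) (Fin n) ℝ) = (lmiOmega h)ᵀ * lmiOmega h := by
  simpa [lmiTheta] using lmiTheta_eq h 1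

/-- The complex form of the dissipation inequality. -/
theorem LMI.exists_complex_dissipation (hWV : IsSVDTransform h W V sys.E) (hε : 0 < ε)
    (hL : L.PosDef)
    (hLMI : LMI h sys W V γ L Q R S Z ε) :
    ∃ κ : ℝ, 0 < κ ∧ ∀ (F : Matrix (Fin m) (Fin n) ℝ) (Δ : Matrix (Fin s) (Fin s) ℝ),
      lmiOmega h * Z = lmiGamma h Q R * (F * V)ᵀ → lmiPhi h * Z = lmiPi h S * (F * V)ᵀ →
      sigmaMax Δ ≤ 1 → ∀ (z : ℂ), 1 ≤ ‖z‖ → ∀ (ξ : Fin n → ℂ) (u : Fin p → ℂ),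
      ξ ᵥ* pencil sys.E (sys.closedA F Δ) z =
        u ᵥ* (sys.C + sys.MC * Δ * sys.NC).map Complex.ofReal →
      ‖WithLp.toLp 2 (ξ ᵥ* (sys.Bw + sys.MB * Δ * sys.NB).map Complex.ofReal
        + u ᵥ* (sys.Dw + sys.MD * Δ * sys.ND).map Complex.ofReal)‖ ^ 2 ≤
        γ ^ 2 * ‖WithLp.toLp 2 u‖ ^ 2 - κ * (‖WithLp.toLp 2 (ξ ᵥ* (W⁻¹).map Complex.ofReal)‖ ^ 2
          + ‖WithLp.toLp 2 u‖ ^ 2) := by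
  obtain ⟨κ, hκ, hle⟩ := hLMI.exists_dissipation h sys W V hε
  refine ⟨κ, hκ, fun F Δ hΩ hΦ hΔ z hz ξ u hξ => ?_⟩
  obtain ⟨η, rfl⟩ : ∃ η : Fin n → ℂ, ξ = η ᵥ* W.map Complex.ofReal :=
    ⟨ξ ᵥ* (W⁻¹).map Complex.ofReal, by
      rw [vecMul_vecMul, ← map_ofReal_mul, nonsing_inv_mul _ hWV.left_nonsingular]
      simp [Matrix.map_one]⟩
  have hη : (η ᵥ* W.map Complex.ofReal) ᵥ* (W⁻¹).map Complex.ofReal = η := by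
    rw [vecMul_vecMul, ← map_ofReal_mul, mul_nonsing_inv _ hWV.left_nonsingular]
    simp [Matrix.map_one]
  rw [hη]
  -- In transformed coordinates `E` is `Ωᵀ Ω`, so the transposed equation has the form required for
  -- dissipation, with `b = z Ω η`.
  have hξ' : η ᵥ* (W * sys.closedA F Δ * V).map Complex.ofReal
      + u ᵥ* ((sys.C + sys.MC * Δ * sys.NC) * V).map Complex.ofReal =
      (z • (η ᵥ* (lmiOmega h)ᵀ.map Complex.ofReal)) ᵥ* (lmiOmega h).map Complex.ofReal := by
    have h1 := congrArg (fun v => v ᵥ* V.map Complex.ofReal) hξ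
    simp only [vecMul_vecMul] at h1
    rw [← pencil_mul_mul, hWV.normal_form, pencil, block_one_zero h,
      vecMul_sub, vecMul_smul, ← map_ofReal_mul] at h1
    rw [smul_vecMul, vecMul_vecMul, ← map_ofReal_mul, ← h1]
    abel
  set v := η ᵥ* (lmiOmega h)ᵀ.map Complex.ofReal with hv
  have hre := congrArg reVec hξ'
  have him := congrArg imVec hξ'
  rw [reVec_add, reVec_vecMul, reVec_vecMul, reVec_vecMul] at hre
  rw [imVec_add, imVec_vecMul, imVec_vecMul, imVec_vecMul] at him
  have hy : (η ᵥ* W.map Complex.ofReal) ᵥ* (sys.Bw + sys.MB * Δ * sys.NB).map Complex.ofReal =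
      η ᵥ* (W * (sys.Bw + sys.MB * Δ * sys.NB)).map Complex.ofReal := by
    rw [vecMul_vecMul, ← map_ofReal_mul]
  rw [hy]
  -- All data except `z` are real, so the real and imaginary parts satisfy the hypotheses
  -- separately.
  have e1 := hle F Δ hΩ hΦ hΔ (reVec η) (reVec u) (reVec (z • v)) _ hre rfl
  have e2 := hle F Δ hΩ hΦ hΔ (imVec η) (imVec u) (imVec (z • v)) _ him rfl
  rw [← reVec_vecMul, ← reVec_vecMul, ← reVec_add] at e1
  rw [← imVec_vecMul, ← imVec_vecMul, ← imVec_add] at e2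
  have hθ : ∀ x : Fin n → ℝ, x ⬝ᵥ lmiTheta h L *ᵥ x =
      (lmiOmega h *ᵥ x) ⬝ᵥ L *ᵥ (lmiOmega h *ᵥ x) := by
    intro x
    rw [lmiTheta_eq, ← mulVec_mulVec, ← mulVec_mulVec, ← dotProduct_mulVec_comm, dotProduct_comm]
  have hvr : lmiOmega h *ᵥ reVec η = reVec v := by
    rw [hv, reVec_vecMul, transpose_transpose]
  have hvi : lmiOmega h *ᵥ imVec η = imVec v := by
    rw [hv, imVec_vecMul, transpose_transpose]
  rw [hθ, hvr, reVec_smul] at e1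
  rw [hθ, hvi, imVec_smul] at e2
  rw [norm_sq_eq_reVec_add_imVec, norm_sq_eq_reVec_add_imVec, norm_sq_eq_reVec_add_imVec]
  -- When `e1` and `e2` are added, the mixed terms in `z.re * z.im` cancel and the storage of `z •
  -- v` is `|z|²` times that of `v`.
  have hzz : 1 ≤ z.re * z.re + z.im * z.im := by
    rw [← Complex.normSq_apply, ← Complex.sq_norm]
    exact one_le_pow₀ hz
  have l1 : 0 ≤ reVec v ⬝ᵥ L *ᵥ reVec v := by
    simpa using hL.posSemidef.dotProduct_mulVec_nonneg (reVec v)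
  have l2 : 0 ≤ imVec v ⬝ᵥ L *ᵥ imVec v := by
    simpa using hL.posSemidef.dotProduct_mulVec_nonneg (imVec v)
  simp only [mulVec_sub, mulVec_add, mulVec_smul, dotProduct_sub, dotProduct_add,
    sub_dotProduct, add_dotProduct, smul_dotProduct, dotProduct_smul, smul_eq_mul] at e1 e2
  have e3 := mul_nonneg (sub_nonneg.mpr hzz) l1
  have e4 := mul_nonneg (sub_nonneg.mpr hzz) l2
  linarith

/-- Dissipation controls row vectors `u P`, while `sigmaMax` concerns `P x`. With `y = P x`, `|y|² =
(y* P) x ≤ g |y| |x|`. -/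
theorem sigmaMax_le_of_vecMul {P : Matrix (Fin p) (Fin q) ℂ} {g : ℝ} (hg : 0 ≤ g)
    (hP : ∀ u : Fin p → ℂ, ‖WithLp.toLp 2 (u ᵥ* P)‖ ^ 2 ≤ g ^ 2 * ‖WithLp.toLp 2 u‖ ^ 2) :
    sigmaMax P ≤ g := by
  refine ContinuousLinearMap.opNorm_le_bound _ hg fun x => ?_
  have hx : ‖(LinearMap.toContinuousLinearMap (Matrix.toLpLin 2 2 P)) x‖ =
      ‖WithLp.toLp 2 (P *ᵥ x.ofLp)‖ := by simp [toLpLin_apply]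
  rw [hx]
  set y := P *ᵥ x.ofLp with hy
  have hstar : ‖WithLp.toLp 2 (star y)‖ = ‖WithLp.toLp 2 y‖ := by
    simp [EuclideanSpace.norm_eq]
  have h1 : ‖WithLp.toLp 2 (star y ᵥ* P)‖ ≤ g * ‖WithLp.toLp 2 y‖ := by
    have := hP (star y)
    rw [hstar, ← mul_pow] at this
    exact (pow_le_pow_iff_left₀ (norm_nonneg _) (by positivity) two_ne_zero).mp this
  have h2 : (‖WithLp.toLp 2 y‖ : ℂ) ^ 2 = (star y ᵥ* P) ⬝ᵥ x.ofLp := by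
    rw [← dotProduct_mulVec, ← hy, dotProduct_comm, ← EuclideanSpace.inner_toLp_toLp,
      inner_self_eq_norm_sq_to_K]
    rfl
  have h3 : ‖WithLp.toLp 2 y‖ ^ 2 ≤ ‖WithLp.toLp 2 (star y ᵥ* P)‖ * ‖x‖ := by
    have h4 := norm_inner_le_norm (𝕜 := ℂ) (WithLp.toLp 2 (star (star y ᵥ* P))) x
    rw [EuclideanSpace.inner_eq_star_dotProduct, star_star, dotProduct_comm, ← h2] at h4
    have h5 : ‖WithLp.toLp 2 (star (star y ᵥ* P))‖ = ‖WithLp.toLp 2 (star y ᵥ* P)‖ := by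
      simp [EuclideanSpace.norm_eq]
    rw [h5] at h4
    simpa using h4
  have h6 := mul_le_mul_of_nonneg_right h1 (norm_nonneg x)
  rcases (norm_nonneg (WithLp.toLp 2 y)).eq_or_lt with h0 | h0
  · rw [← h0]; positivity
  · refine le_of_mul_le_mul_left ?_ h0
    nlinarith

end Complex

/-! ### Admissibility and the `H∞` bound -/

section Admissible

variable {n m p q s r : ℕ} (h : r ≤ n) (sys : UncertainSystem n m p q s)
  (W V : Matrix (Fin n) (Fin n) ℝ) {γ : ℝ} {L Q : Matrix (Fin r) (Fin r) ℝ}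
  {R : Matrix (Fin r) (Fin (n - r)) ℝ} {S : Matrix (Fin (n - r)) (Fin (n - r)) ℝ}
  {Z : Matrix (Fin n) (Fin m) ℝ} {ε : ℝ}

/-- The lower right block of size `n - r`. -/
def lowerRight (M : Matrix (Fin n) (Fin n) ℝ) : Matrix (Fin (n - r)) (Fin (n - r)) ℝ :=
  (M.submatrix (split h) (split h)).toBlocks₂₂

theorem map_C_mul {k l t : ℕ} (M : Matrix (Fin k) (Fin l) ℝ) (N : Matrix (Fin l) (Fin t) ℝ) :
    (M * N).map Polynomial.C = M.map Polynomial.C * N.map Polynomial.C :=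
  Matrix.map_mul (f := Polynomial.C)

theorem pencilPoly_mul_mul (E A : Matrix (Fin n) (Fin n) ℝ) :
    pencilPoly (W * E * V) (W * A * V) =
      Polynomial.C (W.det * V.det) * pencilPoly E A := by
  have hd : ∀ M : Matrix (Fin n) (Fin n) ℝ, (M.map Polynomial.C).det = Polynomial.C M.det :=
    fun M => (RingHom.map_det Polynomial.C M).symm
  have : (Polynomial.X : Polynomial ℝ) • (W * E * V).map Polynomial.C
        - (W * A * V).map Polynomial.C =
      W.map Polynomial.C * ((Polynomial.X : Polynomial ℝ) • E.map Polynomial.C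
        - A.map Polynomial.C) * V.map Polynomial.C := by
    simp only [map_C_mul, Matrix.mul_sub, Matrix.sub_mul, Matrix.mul_smul, Matrix.smul_mul]
  rw [pencilPoly, this, det_mul, det_mul, hd, hd, Polynomial.C_mul, pencilPoly]
  ring

/-- The lower right block of the pencil is the constant `-M₂₂`, so the Schur complement factors the
determinant as `det (-M₂₂)` times the characteristic polynomial of `M₁₁ - M₁₂ M₂₂⁻¹ M₂₁`, an `r × r`
matrix. -/
theorem natDegree_pencilPoly_block {M : Matrix (Fin n) (Fin n) ℝ}
    (hM : IsUnit (lowerRight h M).det) :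
    (pencilPoly (block h 1 0 0 0) M).natDegree = r := by
  set N := M.submatrix (split h) (split h) with hN
  have hdet : pencilPoly (block h 1 0 0 0) M =
      (fromBlocks (charmatrix N.toBlocks₁₁) (-N.toBlocks₁₂.map Polynomial.C)
        (-N.toBlocks₂₁.map Polynomial.C) (-N.toBlocks₂₂.map Polynomial.C)).det := by
    rw [pencilPoly, ← det_submatrix_equiv_self (split h)]
    congr 1
    ext (i | i) (j | j)
    · simp [block, hN, toBlocks₁₁, charmatrix, one_apply, diagonal_apply, apply_ite]
    all_goals simp [block, hN, toBlocks₁₂, toBlocks₂₁, toBlocks₂₂]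
  have hmul : lowerRight h M * (lowerRight h M)⁻¹ = 1 := mul_nonsing_inv _ hM
  have hmul' : (lowerRight h M)⁻¹ * lowerRight h M = 1 := nonsing_inv_mul _ hM
  let _ : Invertible (-N.toBlocks₂₂.map Polynomial.C) :=
    ⟨-((lowerRight h M)⁻¹).map Polynomial.C, by
      rw [neg_mul_neg, ← map_C_mul]
      change ((lowerRight h M)⁻¹ * lowerRight h M).map Polynomial.C = 1
      rw [hmul']; simp [Matrix.map_one], by
      rw [neg_mul_neg, ← map_C_mul]
      change (lowerRight h M * (lowerRight h M)⁻¹).map Polynomial.C = 1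
      rw [hmul]; simp [Matrix.map_one]⟩
  have hschur : charmatrix N.toBlocks₁₁ - (-N.toBlocks₁₂.map Polynomial.C) *
      ⅟(-N.toBlocks₂₂.map Polynomial.C) * (-N.toBlocks₂₁.map Polynomial.C) =
      charmatrix (N.toBlocks₁₁ - N.toBlocks₁₂ * (lowerRight h M)⁻¹ * N.toBlocks₂₁) := by
    change charmatrix N.toBlocks₁₁ - (-N.toBlocks₁₂.map Polynomial.C) *
      (-((lowerRight h M)⁻¹).map Polynomial.C) * (-N.toBlocks₂₁.map Polynomial.C) = _
    simp only [Matrix.neg_mul, Matrix.mul_neg, neg_neg, ← map_C_mul]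
    rw [charmatrix, charmatrix, map_sub (Polynomial.C.mapMatrix)]
    simp only [RingHom.mapMatrix_apply]
    abel
  have hd : (-N.toBlocks₂₂.map Polynomial.C).det = Polynomial.C ((-lowerRight h M).det) := by
    rw [RingHom.map_det, map_neg]
    rfl
  rw [hdet, det_fromBlocks₂₂, hschur, hd, Polynomial.natDegree_C_mul]
  · exact (charpoly_natDegree_eq_dim _).trans (Fintype.card_fin r)
  · rw [det_neg]
    exact mul_ne_zero (pow_ne_zero _ (by norm_num)) hM.ne_zero

/-- A kernel vector `x` of the transposed block, padded by zeros to `η`, annihilates both the `Θ`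
term and the `Π` term, leaving `0 ≤ -κ |x|²`. -/
theorem LMI.isUnit_det_lowerRight (hε : 0 < ε) (hLMI : LMI h sys W V γ L Q R S Z ε)
    {F : Matrix (Fin m) (Fin n) ℝ} {Δ : Matrix (Fin s) (Fin s) ℝ}
    (hΩ : lmiOmega h * Z = lmiGamma h Q R * (F * V)ᵀ)
    (hΦ : lmiPhi h * Z = lmiPi h S * (F * V)ᵀ) (hΔ : sigmaMax Δ ≤ 1) :
    IsUnit (lowerRight h (W * sys.closedA F Δ * V)).det := by
  obtain ⟨κ, hκ, hle⟩ := hLMI.exists_closedLoop_le h sys W V hε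
  rw [← det_transpose, isUnit_iff_ne_zero]
  intro h0
  obtain ⟨x, hx, hMx⟩ := exists_mulVec_eq_zero_iff.mpr h0
  set M := W * sys.closedA F Δ * V with hM
  set η : Fin n → ℝ := Sum.elim 0 x ∘ (split h).symm with hη
  have hmain := hle F Δ hΩ hΦ hΔ 0 η 0 0 0
  have hΘ : η ⬝ᵥ lmiTheta h L *ᵥ η = 0 := by
    rw [lmiTheta, block, submatrix_mulVec_equiv, hη, Equiv.symm_symm]
    simp [Function.comp_assoc, fromBlocks_mulVec]
  have hP : η ⬝ᵥ lmiPi h S *ᵥ (Mᵀ *ᵥ η) = 0 := by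
    have h1 : Mᵀ = (M.submatrix (split h) (split h))ᵀ.submatrix (split h).symm (split h).symm := by
      simp
    rw [h1, lmiPi, block, submatrix_mulVec_equiv, submatrix_mulVec_equiv, hη, Equiv.symm_symm,
      comp_equiv_symm_dotProduct, Function.comp_assoc, Function.comp_assoc, Function.comp_assoc,
      Equiv.symm_comp_self, Function.comp_id, Function.comp_id]
    rw [← fromBlocks_toBlocks (M.submatrix (split h) (split h)), fromBlocks_transpose,
      fromBlocks_mulVec]
    have h2 : (M.submatrix (split h) (split h)).toBlocks₂₂ᵀ *ᵥ x = 0 := hMx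
    simp [fromBlocks_mulVec, h2]
  have hn : η ⬝ᵥ η = x ⬝ᵥ x := by
    rw [hη, comp_equiv_symm_dotProduct, Function.comp_assoc, Equiv.symm_comp_self,
      Function.comp_id, sumElim_dotProduct_sumElim]
    simp
  rw [mulVec_mulVec] at hP
  simp [hM.symm, hΘ, hP, hn] at hmain
  have h1 : x ⬝ᵥ x ≠ 0 := by simpa using hx
  have h2 : 0 < x ⬝ᵥ x := lt_of_le_of_ne (dotProduct_self_nonneg_real x) (Ne.symm h1)
  nlinarith

theorem vecMul_transferFunction {E A : Matrix (Fin n) (Fin n) ℝ}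
    {B : Matrix (Fin n) (Fin q) ℝ} {C : Matrix (Fin p) (Fin n) ℝ} {D : Matrix (Fin p) (Fin q) ℝ}
    {z : ℂ} (u : Fin p → ℂ) :
    u ᵥ* transferFunction E A B C D z =
      (u ᵥ* (C.map Complex.ofReal * (pencil E A z)⁻¹)) ᵥ* B.map Complex.ofReal
        + u ᵥ* D.map Complex.ofReal := by
  rw [transferFunction, vecMul_add, vecMul_vecMul]

theorem LMI.solvedBy (hrank : sys.E.rank = r) (hWV : IsSVDTransform h W V sys.E) (hγ : 0 < γ)
    (hε : 0 < ε) (hL : L.PosDef) (hLMI : LMI h sys W V γ L Q R S Z ε)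
    {F : Matrix (Fin m) (Fin n) ℝ}
    (hΩ : lmiOmega h * Z = lmiGamma h Q R * (F * V)ᵀ)
    (hΦ : lmiPhi h * Z = lmiPi h S * (F * V)ᵀ) : sys.SolvedBy γ F := by
  obtain ⟨κ, hκ, hle⟩ := hLMI.exists_complex_dissipation h sys W V hWV hε hL
  intro Δ hΔ
  have hns : ∀ z : ℂ, 1 ≤ ‖z‖ → (pencil sys.E (sys.closedA F Δ) z).det ≠ 0 := by
    -- A left kernel vector of the pencil satisfies the transposed equation with `u = 0`, so the
    -- margin forces it to vanish.
    intro z hz h0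
    obtain ⟨ξ, hξ, hξ0⟩ := exists_vecMul_eq_zero_iff.mpr h0
    have h1 := hle F Δ hΩ hΦ hΔ z hz ξ 0 (by rw [hξ0, zero_vecMul])
    have h2 : ‖WithLp.toLp 2 (ξ ᵥ* (W⁻¹).map Complex.ofReal)‖ ^ 2 ≤ 0 := by
      have h3 : ‖WithLp.toLp 2 (0 : Fin p → ℂ)‖ = 0 := by simp
      rw [h3] at h1
      have h4 := h1.trans' (sq_nonneg _)
      nlinarith
    have h3 : ξ ᵥ* (W⁻¹).map Complex.ofReal = 0 := by
      have := pow_eq_zero_iff two_ne_zero |>.mp (le_antisymm h2 (sq_nonneg _))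
      simpa using this
    apply hξ
    have h5 := congrArg (fun v => v ᵥ* W.map Complex.ofReal) h3
    simp only [vecMul_vecMul, zero_vecMul] at h5
    rw [← map_ofReal_mul, nonsing_inv_mul _ hWV.left_nonsingular] at h5
    simpa [Matrix.map_one] using h5
  refine ⟨⟨⟨1, hns 1 (by simp)⟩, ?_, fun z hz => ?_⟩, ?_⟩
  · have h1 := natDegree_pencilPoly_block h
      (hLMI.isUnit_det_lowerRight h sys W V hε hΩ hΦ hΔ)
    rw [← hWV.normal_form, pencilPoly_mul_mul, Polynomial.natDegree_C_mul] at h1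
    · rw [h1, hrank]
    · exact mul_ne_zero hWV.left_nonsingular.ne_zero hWV.right_nonsingular.ne_zero
  · by_contra hlt
    exact hns z (not_lt.mp hlt) hz
  -- Since `κ` does not depend on `z`, this one bound serves all `|z| ≥ 1` and the supremum stays
  -- strictly below `γ`. The maximum with `0` covers `κ > γ²`.
  · have hlt : Real.sqrt (max (γ ^ 2 - κ) 0) < γ := by
      rw [Real.sqrt_lt' hγ]
      exact max_lt (by linarith) (by positivity)
    refine lt_of_le_of_lt (iSup_le fun z => ?_) ((ENNReal.ofReal_lt_ofReal_iff hγ).mpr hlt)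
    refine ENNReal.ofReal_le_ofReal (sigmaMax_le_of_vecMul (Real.sqrt_nonneg _) fun u => ?_)
    rw [Real.sq_sqrt (le_max_right _ _), UncertainSystem.closedTransfer, vecMul_transferFunction]
    refine (hle F Δ hΩ hΦ hΔ z.1 z.2 _ u ?_).trans ?_
    · rw [vecMul_vecMul, Matrix.mul_assoc,
        nonsing_inv_mul _ (isUnit_iff_ne_zero.mpr (hns z.1 z.2)), Matrix.mul_one]
    · have h1 := mul_le_mul_of_nonneg_right (le_max_left (γ ^ 2 - κ) 0)
        (sq_nonneg ‖WithLp.toLp 2 u‖)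
      have h2 := mul_nonneg hκ.le (sq_nonneg ‖WithLp.toLp 2
        ((u ᵥ* ((sys.C + sys.MC * Δ * sys.NC).map Complex.ofReal *
          (pencil sys.E (sys.closedA F Δ) z.1)⁻¹)) ᵥ* (W⁻¹).map Complex.ofReal)‖)
      linarith

end Admissible

/-! ### The explicit gain -/

section Gain

variable {n m p q s r : ℕ} (h : r ≤ n) (sys : UncertainSystem n m p q s)
  (W V : Matrix (Fin n) (Fin n) ℝ) {γ : ℝ} {L Q : Matrix (Fin r) (Fin r) ℝ}
  {R : Matrix (Fin r) (Fin (n - r)) ℝ} {S : Matrix (Fin (n - r)) (Fin (n - r)) ℝ}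
  {Z : Matrix (Fin n) (Fin m) ℝ} {ε : ℝ}

/-- For invertible `Q` and `S` the block factor is the inverse of `[[Q, R], [0, S]]`: its products
with `Γ` and `Π` are `Ω` and `Φ`, which gives the two gain equations. -/
theorem gain_mul_transpose (hV : IsUnit V.det) :
    (gain h V Q R S Z * V)ᵀ = block h Q⁻¹ (-(Q⁻¹ * R * S⁻¹)) 0 S⁻¹ * Z := by
  rw [gain, Matrix.mul_assoc, nonsing_inv_mul _ hV, Matrix.mul_one, transpose_mul,
    transpose_transpose]
  congr 1
  simp [block, fromBlocks_transpose, transpose_nonsing_inv, Matrix.mul_assoc]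

theorem lmiOmega_mul_eq (hV : IsUnit V.det) (hQ : IsUnit Q.det) :
    lmiOmega h * Z = lmiGamma h Q R * (gain h V Q R S Z * V)ᵀ := by
  rw [gain_mul_transpose h V hV, ← Matrix.mul_assoc]
  congr 1
  simp [lmiOmega, lmiGamma, blockRow, block, submatrix_mul_equiv, fromCols_mul_fromBlocks,
    mul_nonsing_inv _ hQ, ← Matrix.mul_assoc]

theorem lmiPhi_mul_eq (hV : IsUnit V.det) (hS : IsUnit S.det) :
    lmiPhi h * Z = lmiPi h S * (gain h V Q R S Z * V)ᵀ := by
  rw [gain_mul_transpose h V hV, ← Matrix.mul_assoc]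
  congr 1
  simp [lmiPhi, lmiPi, block, submatrix_mul_equiv, fromBlocks_multiply,
    mul_nonsing_inv _ hS]

theorem LMI.gain_solvedBy (hrank : sys.E.rank = r) (hWV : IsSVDTransform h W V sys.E) (hγ : 0 < γ)
    (hε : 0 < ε) (hL : L.PosDef) (hLMI : LMI h sys W V γ L Q R S Z ε) (hS : IsUnit S.det) :
    sys.SolvedBy γ (gain h V Q R S Z) :=
  hLMI.solvedBy h sys W V hrank hWV hγ hε hL
    (lmiOmega_mul_eq h V hWV.right_nonsingular (hLMI.isUnit_det h sys W V))
    (lmiPhi_mul_eq h V hWV.right_nonsingular hS)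

end Gain

/-! ### Perturbing a singular `S` -/

section Perturbation

variable {n m p q s r : ℕ} (h : r ≤ n) (sys : UncertainSystem n m p q s)
  (W V : Matrix (Fin n) (Fin n) ℝ) {γ : ℝ} {L Q : Matrix (Fin r) (Fin r) ℝ}
  {R : Matrix (Fin r) (Fin (n - r)) ℝ} {S : Matrix (Fin (n - r)) (Fin (n - r)) ℝ}
  {Z : Matrix (Fin n) (Fin m) ℝ} {ε : ℝ}

theorem continuous_lmiPi {X : ℝ → Matrix (Fin (n - r)) (Fin (n - r)) ℝ} (hX : Continuous X) :
    Continuous fun t => lmiPi h (X t) :=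
  (Continuous.matrix_fromBlocks continuous_const continuous_const continuous_const hX).matrix_submatrix
    _ _

theorem continuous_lmiMatrix {X : ℝ → Matrix (Fin (n - r)) (Fin (n - r)) ℝ} (hX : Continuous X) :
    Continuous fun t => lmiMatrix h sys W V γ L Q R (X t) Z ε := by
  have hP := continuous_lmiPi h hX
  have hΛ : Continuous fun t => lmiLambda h sys W V γ L Q R (X t) Z := by
    have h₂₂ : Continuous fun t => lmiPi h (X t) * (W * sys.A * V)ᵀ
        + (W * sys.A * V) * (lmiPi h (X t))ᵀ + lmiPhi h * Z * (W * sys.Bu)ᵀ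
        + (W * sys.Bu) * Zᵀ * (lmiPhi h)ᵀ - lmiTheta h L := by fun_prop
    have h₃₂ : Continuous fun t => (sys.C * V) * (lmiPi h (X t))ᵀ := by fun_prop
    refine continuous_matrix fun i j => ?_
    rcases i with i | i | i | i | i <;> rcases j with j | j | j | j | j <;>
      first
        | exact continuous_const
        | exact h₂₂.matrix_elem i j
        | exact h₃₂.matrix_elem i j
        | exact h₃₂.matrix_elem j i
  have hN : Continuous fun t => (lmiN₂ h sys V Q R (X t) :
      Matrix (LmiIdx r n p q) (UncIdx s) ℝ) := by
    have h₁ : Continuous fun t => lmiPi h (X t) * (sys.NA * V)ᵀ := by fun_prop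
    have h₂ : Continuous fun t => lmiPi h (X t) * (sys.NC * V)ᵀ := by fun_prop
    refine continuous_matrix fun i j => ?_
    rcases i with i | i | i | i | i <;> rcases j with j | j | j | j <;>
      first
        | exact continuous_const
        | exact h₁.matrix_elem i j
        | exact h₂.matrix_elem i j
  exact Continuous.matrix_fromBlocks (hΛ.add continuous_const) hN hN.matrix_transpose
    continuous_const

/-- Supplies the symmetry needed by `eventually_posDef`; only the diagonal blocks require an
argument. -/
theorem lmiMatrix_transpose (hL : Lᵀ = L) :
    (lmiMatrix h sys W V γ L Q R S Z ε)ᵀ = lmiMatrix h sys W V γ L Q R S Z ε := by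
  have hΘ : (lmiTheta h L)ᵀ = lmiTheta h L := by
    simp [lmiTheta, block, fromBlocks_transpose, hL]
  have hΛ : (lmiLambda h sys W V γ L Q R S Z)ᵀ = lmiLambda h sys W V γ L Q R S Z := by
    have h₁₁ : (-(1 / 2 : ℝ) • Q - (1 / 2 : ℝ) • Qᵀ)ᵀ = -(1 / 2 : ℝ) • Q - (1 / 2 : ℝ) • Qᵀ := by
      simp only [transpose_sub, transpose_smul, transpose_transpose, neg_smul, transpose_neg]
      abel
    have h₂₂ : (lmiPi h S * (W * sys.A * V)ᵀ
        + (W * sys.A * V) * (lmiPi h S)ᵀ + lmiPhi h * Z * (W * sys.Bu)ᵀ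
        + (W * sys.Bu) * Zᵀ * (lmiPhi h)ᵀ - lmiTheta h L)ᵀ = lmiPi h S * (W * sys.A * V)ᵀ
        + (W * sys.A * V) * (lmiPi h S)ᵀ + lmiPhi h * Z * (W * sys.Bu)ᵀ
        + (W * sys.Bu) * Zᵀ * (lmiPhi h)ᵀ - lmiTheta h L := by
      generalize W * sys.A * V = Ad, W * sys.Bu = Bu
      simp only [transpose_sub, transpose_add, transpose_mul, transpose_transpose, hΘ,
        Matrix.mul_assoc]
      abel
    have h₃₃ : ((-(γ ^ 2)) • (1 : Matrix (Fin p) (Fin p) ℝ))ᵀ = (-(γ ^ 2)) • 1 := by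
      rw [transpose_smul, transpose_one]
    have h₄₄ : (-(Q + Qᵀ))ᵀ = -(Q + Qᵀ) := by
      rw [transpose_neg, transpose_add, transpose_transpose, add_comm]
    have h₅₅ : (-(1 : Matrix (Fin q) (Fin q) ℝ))ᵀ = -1 := by
      rw [transpose_neg, transpose_one]
    ext i j
    rcases i with i | i | i | i | i <;> rcases j with j | j | j | j | j <;>
      first
        | rfl
        | exact congrFun₂ h₁₁ i j
        | exact congrFun₂ h₂₂ i j
        | exact congrFun₂ h₃₃ i j
        | exact congrFun₂ h₄₄ i j
        | exact congrFun₂ h₅₅ i j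
  simp only [lmiMatrix, fromBlocks_transpose, transpose_add, transpose_smul, transpose_mul,
    transpose_transpose, hΛ, transpose_one]

theorem LMI.exists_perturbation (hL : L.PosDef) (hLMI : LMI h sys W V γ L Q R S Z ε) :
    ∃ δ : ℝ, 0 < δ ∧ δ < 1 ∧ IsUnit (S + δ • (1 : Matrix (Fin (n - r)) (Fin (n - r)) ℝ)).det ∧
      LMI h sys W V γ L Q R (S + δ • (1 : Matrix (Fin (n - r)) (Fin (n - r)) ℝ)) Z ε := by
  have hLs : Lᵀ = L := by
    have := hL.isHermitian
    rwa [IsHermitian, conjTranspose_eq_transpose_of_trivial] at this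
  have hev := eventually_posDef
    (f := fun t : ℝ => -lmiMatrix h sys W V γ L Q R
      (S + t • (1 : Matrix (Fin (n - r)) (Fin (n - r)) ℝ)) Z ε)
    (continuous_lmiMatrix h sys W V (by fun_prop)).neg
    (fun t => by rw [transpose_neg, lmiMatrix_transpose h sys W V hLs])
    (by simpa using (LMI_iff _ _ _ _ _ _ _ _ _ _ _).mp hLMI)
  obtain ⟨δ₀, hδ₀, hball⟩ := Metric.eventually_nhds_iff.mp hev
  have hinf : (Set.Ioo 0 (min δ₀ 1)).Infinite := Set.Ioo_infinite (lt_min hδ₀ one_pos)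
  -- `S + t I` is singular exactly when `t` is an eigenvalue of `-S`, so infinitely many small `t`
  -- remain admissible.
  have hfin : {t : ℝ | (-S).charpoly.IsRoot t}.Finite :=
    Polynomial.finite_setOfPred_isRoot (charpoly_monic _).ne_zero
  obtain ⟨δ, hδ, hroot⟩ := (hinf.sdiff hfin).nonempty
  refine ⟨δ, hδ.1, hδ.2.trans_le (min_le_right _ _), ?_, hball ?_⟩
  · rw [isUnit_iff_ne_zero]
    intro h0
    apply hroot
    rw [Set.mem_ofPred_eq, Polynomial.IsRoot.def, eval_charpoly, sub_neg_eq_add, add_comm, ← h0]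
    congr 2
    rw [smul_one_eq_diagonal]
    rfl
  · rw [Real.dist_eq, sub_zero, abs_of_pos hδ.1]
    exact hδ.2.trans_le (min_le_left _ _)

end Perturbation

end Descriptor

end

theorem theorem2 {n m p q s r : ℕ} (sys : Descriptor.UncertainSystem n m p q s)
    (hrank : sys.E.rank = r) (hr : r < n)
    (W V : Matrix (Fin n) (Fin n) ℝ) (hWV : Descriptor.IsSVDTransform hr.le W V sys.E)
    (γ : ℝ) (hγ : 0 < γ)
    (L Q : Matrix (Fin r) (Fin r) ℝ) (R : Matrix (Fin r) (Fin (n - r)) ℝ)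
    (S : Matrix (Fin (n - r)) (Fin (n - r)) ℝ) (Z : Matrix (Fin n) (Fin m) ℝ) (ε : ℝ)
    (hL : L.PosDef) (hε : 0 < ε)
    (hLMI : Descriptor.LMI hr.le sys W V γ L Q R S Z ε) :
    (∃ F : Matrix (Fin m) (Fin n) ℝ, sys.SolvedBy γ F) ∧
    IsUnit Q.det ∧
    (IsUnit S.det → sys.SolvedBy γ (Descriptor.gain hr.le V Q R S Z)) ∧
    (¬ IsUnit S.det → ∃ δ : ℝ, 0 < δ ∧ δ < 1 ∧
      IsUnit (S + δ • (1 : Matrix (Fin (n - r)) (Fin (n - r)) ℝ)).det ∧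
      Descriptor.LMI hr.le sys W V γ L Q R
        (S + δ • (1 : Matrix (Fin (n - r)) (Fin (n - r)) ℝ)) Z ε ∧
      sys.SolvedBy γ (Descriptor.gain hr.le V Q R
        (S + δ • (1 : Matrix (Fin (n - r)) (Fin (n - r)) ℝ)) Z)) := by
  have hmain := fun hS => hLMI.gain_solvedBy hr.le sys W V hrank hWV hγ hε hL hS
  -- The perturbation works whether or not `S` is invertible, so it also yields the bare existence
  -- of a gain without a case split.
  have hpert : ∃ δ : ℝ, 0 < δ ∧ δ < 1 ∧
      IsUnit (S + δ • (1 : Matrix (Fin (n - r)) (Fin (n - r)) ℝ)).det ∧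
      Descriptor.LMI hr.le sys W V γ L Q R
        (S + δ • (1 : Matrix (Fin (n - r)) (Fin (n - r)) ℝ)) Z ε ∧
      sys.SolvedBy γ (Descriptor.gain hr.le V Q R
        (S + δ • (1 : Matrix (Fin (n - r)) (Fin (n - r)) ℝ)) Z) := by
    obtain ⟨δ, h0, h1, hS, hδ⟩ := hLMI.exists_perturbation hr.le sys W V hL
    exact ⟨δ, h0, h1, hS, hδ, hδ.gain_solvedBy hr.le sys W V hrank hWV hγ hε hL hS⟩
  refine ⟨?_, hLMI.isUnit_det hr.le sys W V, hmain, fun _ => hpert⟩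
  obtain ⟨δ, -, -, -, -, hF⟩ := hpert
  exact ⟨_, hF⟩
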